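/- Let $p$ be an odd prime, let $n\ge 1$ be an integer, and let $L_n/L$ be a cyclic (Galois) extension of number fields of degree $p^n$ with Galois group $\Gamma$. Write $\mathcal{O}_{L_n}^\times$ for the group of units of the ring of integers of $L_n$, and $\mu_L$, $\mu_{L_n}$ for the groups of roots of unity of $L$ and $L_n$. Assume that $N_{L_n/L}(\mu_{L_n})=\mu_L$. Let $\mathcal{E}_{L_n}:=\mathbb{Z}_p\otimes_{\mathbb{Z}}(\mathcal{O}_{L_n}^\times/\mu_{L_n})$ with its natural structure of $\mathbb{Z}_p[\Gamma]$-module. For $0\le i\le n$ let $\Gamma_i$ be the unique subgroup of $\Gamma$ of order $p^i$, and let $\Gamma$ act on $H^1(\Gamma_i,\mathcal{E}_{L_n})$ in the usual way, that is, by $(g f)(s)=g\,f(g^{-1}sg)$ on $1$-cocycles $f:\Gamma_i\to\mathcal{E}_{L_n}$. Let $r_{n,0}$ be the number of finite primes of $L$ that ramify in $L_n$, and let $\delta_0:=\dim_{\mathbb{F}_p}(\mathrm{Cl}_L/p)$, where $\mathrm{Cl}_L$ is the ideal class group of $L$. For a finite abelian group $\mathfrak{A}$ let $\mathrm{v}_p(\mathfrak{A})$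 be the exponent of $p$ in its order $|\mathfrak{A}|$. Then for every integer $i$ with $1\le i\le n-1$, the group $H^1(\Gamma_i,\mathcal{E}_{L_n})^{\Gamma}$ of $\Gamma$-invariants is finite and $$\mathrm{v}_p\big(H^1(\Gamma_i,\mathcal{E}_{L_n})^{\Gamma}\big)\;\le\; r_{n,0}\cdot i\cdot(2+n-i)+\delta_0\cdot i\cdot(n-i+1)-i\cdot n+i^2 .$$ -/

import Mathlib

open scoped NumberField TensorProduct

namespace UnitCohomology

section Cohomology

variable {k G A : Type*} [CommRing k] [Group G] [AddCommGroup A] [Module k A]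

/-- The `1`-cocycles `f : G → A` of a representation: `f (g h) = g f(h) + f(g)`. -/
def cocycles (ρ : Representation k G A) : Submodule k (G → A) where
  carrier := {f | ∀ g h : G, f (g * h) = ρ g (f h) + f g}
  zero_mem' := fun g h => by simp
  add_mem' := fun {a b} ha hb g h => by
    simp only [Pi.add_apply, ha g h, hb g h, map_add]
    abel
  smul_mem' := fun c f hf g h => by
    simp only [Pi.smul_apply, hf g h, map_smul, smul_add]

/-- The `1`-coboundaries `g ↦ g a - a` of a representation. -/
def coboundaries (ρ : Representation k G A) : Submodule k (G → A) :=
  LinearMap.range (LinearMap.pi fun g => ρ g - LinearMap.id : A →ₗ[k] G → A)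

/-- The first cohomology group: `1`-cocycles (all of which contain the coboundaries)
modulo `1`-coboundaries. -/
abbrev H1 (ρ : Representation k G A) : Type _ :=
  cocycles ρ ⧸ (coboundaries ρ).submoduleOf (cocycles ρ)

variable (ρ : Representation k G A) (N : Subgroup G)

/-- The restriction of a representation to a subgroup. -/
abbrev resRep : Representation k N A := ρ.comp N.subtype

variable [N.Normal]

/-- `s ↦ g⁻¹ s g` on a normal subgroup. -/
def conjInv (g : G) (s : N) : N :=
  ⟨g⁻¹ * s * g, Subgroup.Normal.conj_mem' ‹N.Normal› s s.2 g⟩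

/-- The action of `g ∈ G` on cocycles of a normal subgroup `N`:
`(g f)(s) = g f(g⁻¹ s g)`. -/
def conjCocycle (g : G) : cocycles (resRep ρ N) →ₗ[k] cocycles (resRep ρ N) where
  toFun f := ⟨fun s => ρ g (f.1 (conjInv N g s)), fun s t => by
    have h1 : conjInv N g (s * t) = conjInv N g s * conjInv N g t := by
      ext
      simp [conjInv, mul_assoc]
    have h2 := f.2 (conjInv N g s) (conjInv N g t)
    beta_reduce
    rw [h1, h2, map_add]
    congr 1
    simp only [MonoidHom.comp_apply, ← Module.End.mul_apply, ← map_mul]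
    congr 2
    simp [conjInv, mul_assoc]⟩
  map_add' f₁ f₂ := by
    ext s
    simp
  map_smul' c f := by
    ext s
    simp

theorem conjCocycle_coboundaries (g : G) :
    (coboundaries (resRep ρ N)).submoduleOf (cocycles (resRep ρ N)) ≤
      ((coboundaries (resRep ρ N)).submoduleOf (cocycles (resRep ρ N))).comap
        (conjCocycle ρ N g) := by
  rintro ⟨f, hf⟩ ⟨a, ha⟩
  refine ⟨ρ g a, ?_⟩
  funext s
  have h : f (conjInv N g s) = ρ (g⁻¹ * s * g) a - a := by
    have := congrFun ha (conjInv N g s)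
    simpa [conjInv] using this.symm
  simp only [LinearMap.pi_apply, Submodule.coe_subtype, conjCocycle, LinearMap.coe_mk,
    AddHom.coe_mk, h, map_sub, LinearMap.sub_apply, MonoidHom.comp_apply,
    ← Module.End.mul_apply, ← map_mul, Subgroup.subtype_apply]
  congr 3
  group

/-- The action of `G` on `H¹(N, A)` for a normal subgroup `N` of `G`, induced by
`(g f)(s) = g f(g⁻¹ s g)` on cocycles. -/
def conjRep : Representation k G (H1 (resRep ρ N)) where
  toFun g := Submodule.mapQ _ _ (conjCocycle ρ N g) (conjCocycle_coboundaries ρ N g)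
  map_one' := by
    apply Submodule.linearMap_qext
    ext f : 1
    simp only [LinearMap.comp_apply, Submodule.mkQ_apply, Submodule.mapQ_apply,
      Module.End.one_apply]
    congr 1
    ext s
    simp [conjCocycle, conjInv]
  map_mul' g h := by
    apply Submodule.linearMap_qext
    ext f : 1
    simp only [LinearMap.comp_apply, Submodule.mkQ_apply, Submodule.mapQ_apply,
      Module.End.mul_apply]
    congr 1
    ext s
    simp [conjCocycle, conjInv, mul_assoc]

end Cohomology

section Units

variable (L F : Type*) [Field L] [Field F] [Algebra L F]

/-- `E_F`: the units of the ring of integers modulo the roots of unity. -/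
def UnitsModTorsion (F : Type*) [Field F] : Type _ :=
  (𝓞 F)ˣ ⧸ NumberField.Units.torsion F

noncomputable instance (F : Type*) [Field F] : CommGroup (UnitsModTorsion F) :=
  inferInstanceAs (CommGroup ((𝓞 F)ˣ ⧸ NumberField.Units.torsion F))

/-- The action of a Galois automorphism on the units of the ring of integers. -/
noncomputable def galUnits (σ : Gal(F/L)) : (𝓞 F)ˣ →* (𝓞 F)ˣ :=
  Units.map (NumberField.RingOfIntegers.mapRingHom (σ : F →+* F) : 𝓞 F →* 𝓞 F)

theorem galUnits_torsion (σ : Gal(F/L)) :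
    NumberField.Units.torsion F ≤ (NumberField.Units.torsion F).comap (galUnits L F σ) :=
  fun _ hx => MonoidHom.isOfFinOrder (galUnits L F σ) hx

/-- The induced Galois action on `E_F`. -/
noncomputable def galUnitsModTorsion (σ : Gal(F/L)) : UnitsModTorsion F →* UnitsModTorsion F :=
  QuotientGroup.map _ _ (galUnits L F σ) (galUnits_torsion L F σ)

/-- The Galois module `E_F`, written additively. -/
noncomputable def unitsRep : Representation ℤ Gal(F/L) (Additive (UnitsModTorsion F)) where
  toFun σ := (MonoidHom.toAdditive (galUnitsModTorsion L F σ)).toIntLinearMap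
  map_one' := by
    ext x
    induction x using Additive.rec with | ofMul x => ?_
    induction x using QuotientGroup.induction_on with | H u => ?_
    rfl
  map_mul' σ τ := by
    ext x
    induction x using Additive.rec with | ofMul x => ?_
    induction x using QuotientGroup.induction_on with | H u => ?_
    rfl

/-- The `ℤ_p[Gal(F/L)]`-module `ℤ_p ⊗ E_F`. -/
noncomputable def padicUnitsRep (p : ℕ) [Fact p.Prime] :
    Representation ℤ_[p] Gal(F/L) (ℤ_[p] ⊗[ℤ] Additive (UnitsModTorsion F)) where
  toFun σ := (unitsRep L F σ).baseChange ℤ_[p]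
  map_one' := by
    rw [map_one]
    exact LinearMap.baseChange_id
  map_mul' σ τ := by
    rw [map_mul]
    exact LinearMap.baseChange_comp _ _

/-- The set of finite primes of `L` that ramify in `F`. -/
def ramifiedPrimes [NumberField L] [NumberField F] :
    Set (IsDedekindDomain.HeightOneSpectrum (𝓞 L)) :=
  {v | ∃ P : Ideal (𝓞 F), P.IsPrime ∧ P.LiesOver v.asIdeal ∧ P.ramificationIdx (𝓞 L) ≠ 1}

/-- The `p`-rank `dim_{𝔽_p} Cl_L / p` of the ideal class group. -/
noncomputable def classGroupRank (p : ℕ) [Fact p.Prime] : ℕ :=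
  Module.finrank (ZMod p) (ModN (Additive (ClassGroup (𝓞 L))) p)

end Units

end UnitCohomology

/-! Let `g` generate Γ, let m = n - i and q = p^m, so that `g ^ q` generates Γ_i, and let E be the
units modulo torsion, with γ acting as `g`. The proof bounds the invariants by the classes of units
killed by the norm of Γ modulo (γ - 1)E, with a gain of p^m.

A cocycle on Γ_i is determined by its value x at `g ^ q`. Its class is Γ-invariant when (γ - 1)x
lies in the image of γ^q - 1. Since E is p-adically dense and pure in ℤ_p ⊗ E, such x can be
replaced by elements of E, and the count takes place in the lattice E (`card_invariants_le`).

Multiplication by 1 + γ + ... + γ^(q-1) compares these classes with ker(Norm_Γ)/(γ - 1)E. The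
discrepancies on the two sides are the Tate groups of degrees -1 and 0 of Γ/Γ_i acting on the
Γ_i-fixed part of E. By Dirichlet's theorem the fixed part under γ^(p^j) has rank p^j s - 1, where s
is the number of infinite places of L; no infinite place ramifies because p is odd. This forces the
ratio of those Tate groups to be p^m (`herbrand`), whence the gain (`relIndex_fixedClasses_mul_le`).

A unit whose norm is a root of unity has norm 1 after correction by a root of unity, so by Hilbert
90 it equals g(a)/a. The valuations of `a` modulo p^n at one prime above each ramified prime take at
most p^(n r) values. Once these are fixed, the quotient of two such `a` generates, up to a factor
from L, an ideal extended from L whose class is killed by p^n, which leaves at most p^(n δ)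
possibilities (`relIndex_ker_norm_le`).

Altogether v + m ≤ n(r + δ). As m ≥ 1, this forces r + δ ≥ 1, and the stated bound follows by
arithmetic. -/

namespace UnitCohomology

/-! ### Indices and ranks of subgroups of a lattice. -/

section IndexCalculus

variable {E E' : Type*} [AddCommGroup E] [AddCommGroup E']

theorem relIndex_map_of_ker_inf_le (f : E →+ E') {A B : AddSubgroup E} (hAB : A ≤ B)
    (h : f.ker ⊓ B ≤ A) : (A.map f).relIndex (B.map f) = A.relIndex B := by
  rw [AddSubgroup.relIndex_map_map]
  have h1 : B ⊔ f.ker = B ⊔ (A ⊔ f.ker) := by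
    rw [← sup_assoc, sup_eq_left.2 hAB]
  rw [h1, AddSubgroup.relIndex_sup_right, ← AddSubgroup.inf_relIndex_right,
    sup_inf_assoc_of_le _ hAB, sup_eq_left.2 h]

theorem relIndex_sup_of_inf (A B : AddSubgroup E) :
    A.relIndex (A ⊔ B) = (A ⊓ B).relIndex B := by
  rw [sup_comm, AddSubgroup.relIndex_sup_right, AddSubgroup.inf_relIndex_right]

instance freeAddSubgroup [Module.Free ℤ E] [Module.Finite ℤ E] (H : AddSubgroup E) : Module.Free ℤ H :=
  inferInstanceAs (Module.Free ℤ (AddSubgroup.toIntSubmodule H))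

instance finiteAddSubgroup [Module.Finite ℤ E] (H : AddSubgroup E) : Module.Finite ℤ H :=
  inferInstanceAs (Module.Finite ℤ (AddSubgroup.toIntSubmodule H))

theorem finrank_mono_addSubgroup [Module.Finite ℤ E] {A B : AddSubgroup E} (h : A ≤ B) :
    Module.finrank ℤ A ≤ Module.finrank ℤ B :=
  Submodule.finrank_mono (s := AddSubgroup.toIntSubmodule A) (t := AddSubgroup.toIntSubmodule B) h

theorem finrank_map_add_finrank_ker [Module.Finite ℤ E] (f : E →+ E') (V : AddSubgroup E) :
    Module.finrank ℤ (V.map f) + Module.finrank ℤ (f.ker ⊓ V : AddSubgroup E) =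
      Module.finrank ℤ V := by
  let F : V →ₗ[ℤ] E' := (f.comp V.subtype).toIntLinearMap
  have h := Submodule.finrank_quotient_add_finrank (LinearMap.ker F)
  rw [F.quotKerEquivRange.finrank_eq] at h
  have h1 : LinearMap.range F = AddSubgroup.toIntSubmodule (V.map f) := by
    ext x
    change (∃ y : V, f y = x) ↔ ∃ y ∈ V, f y = x
    simp
  let e : LinearMap.ker F ≃+ (f.ker ⊓ V : AddSubgroup E) :=
    { toFun := fun x => ⟨x.1.1, x.2, x.1.2⟩
      invFun := fun x => ⟨⟨x.1, x.2.2⟩, x.2.1⟩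
      left_inv := fun x => rfl
      right_inv := fun x => rfl
      map_add' := fun x y => rfl }
  have h3 := e.toIntLinearEquiv.finrank_eq
  rw [h1] at h
  rw [← h, h3]
  rfl

variable [Module.Free ℤ E] [Module.Finite ℤ E]

theorem relIndex_nsmul (k : ℕ) [NeZero k] (H : AddSubgroup E) :
    (H.map (nsmulAddMonoidHom k : E →+ E)).relIndex H = k ^ Module.finrank ℤ H := by
  rw [← ModN.natCard_eq, AddSubgroup.relIndex, AddSubgroup.index]
  refine Nat.card_congr (QuotientAddGroup.quotientAddEquivOfEq (N := Submodule.toAddSubgroup _) ?_).toEquiv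
  ext ⟨x, hx⟩
  simp [AddSubgroup.mem_addSubgroupOf, Subtype.ext_iff]

theorem finrank_eq_of_nsmul_le {k : ℕ} (hk : k ≠ 0) {A B : AddSubgroup E} (h : A ≤ B)
    (hB : ∀ x ∈ B, k • x ∈ A) : Module.finrank ℤ A = Module.finrank ℤ B := by
  refine le_antisymm (finrank_mono_addSubgroup h) ?_
  have h1 := finrank_map_add_finrank_ker (nsmulAddMonoidHom k : E →+ E) B
  have h2 : (nsmulAddMonoidHom k : E →+ E).ker = ⊥ := by
    rw [eq_bot_iff]
    intro x hx
    have hx' : (k : ℤ) • x = 0 := (natCast_zsmul x k).trans hx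
    exact (smul_eq_zero.1 hx').resolve_left (by exact_mod_cast hk)
  rw [h2, bot_inf_eq] at h1
  have h3 : B.map (nsmulAddMonoidHom k : E →+ E) ≤ A := by
    rintro _ ⟨x, hx, rfl⟩
    exact hB x hx
  have := finrank_mono_addSubgroup h3
  have h4 : Module.finrank ℤ (⊥ : AddSubgroup E) = 0 := Module.finrank_zero_of_subsingleton
  omega

end IndexCalculus

/-! ### Multiplication by ring elements, and Eisenstein relations. -/

section Action

variable {R E : Type*} [CommRing R] [AddCommGroup E] [Module R E]

/-- Multiplication by a scalar, as an additive map. -/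
abbrev sm (E : Type*) [AddCommGroup E] [Module R E] (a : R) : E →+ E :=
  DistribSMul.toAddMonoidHom E a

theorem map_sm_mul (a b : R) (V : AddSubgroup E) :
    V.map (sm E (a * b)) = (V.map (sm E b)).map (sm E a) := by
  rw [AddSubgroup.map_map]
  congr 1
  ext x
  simp [mul_smul]

theorem relIndex_map_pow {a : R} {V : AddSubgroup E} (hV : V.map (sm E a) ≤ V)
    (h : ∀ x ∈ V, a • x = 0 → x = 0) (k : ℕ) :
    V.map (sm E (a ^ k)) ≤ V ∧
    (V.map (sm E (a ^ k))).relIndex V = ((V.map (sm E a)).relIndex V) ^ k := by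
  induction k with
  | zero =>
    have : V.map (sm E (a ^ 0)) = V := by
      ext x
      simp
    rw [this]
    simp
  | succ k ih =>
    have h1 : V.map (sm E (a ^ (k + 1))) = (V.map (sm E (a ^ k))).map (sm E a) := by
      rw [pow_succ', map_sm_mul]
    have h2 := AddSubgroup.map_mono (f := sm E a) ih.1
    rw [h1]
    refine ⟨h2.trans hV, ?_⟩
    rw [← AddSubgroup.relIndex_mul_relIndex _ _ _ h2 hV, pow_succ, ← ih.2]
    congr 1
    refine relIndex_map_of_ker_inf_le _ ih.1 ?_
    rintro x ⟨hx, hxV⟩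
    rw [h x hxV hx]
    exact zero_mem _

/-- If `γ - 1` satisfies an Eisenstein relation of degree `d` on `T`, then `(γ-1)^d T = p T`. -/
theorem map_pow_eq_map_prime (p d : ℕ) (x c : R) (T : AddSubgroup E)
    (hT : ∀ a : R, ∀ t ∈ T, a • t ∈ T)
    (h : ∀ t ∈ T, x ^ d • t = ((p : R) * (-1 + x * c)) • t) :
    T.map (sm E (x ^ d)) = T.map (nsmulAddMonoidHom p) := by
  apply le_antisymm
  · rintro _ ⟨t, ht, rfl⟩
    refine ⟨(-1 + x * c) • t, hT _ _ ht, ?_⟩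
    change p • _ = x ^ d • t
    rw [h t ht, mul_smul, Nat.cast_smul_eq_nsmul]
  -- A truncated geometric series inverts -1 + x c up to a remainder x^k c^k; at k = d the remainder
  -- is itself a multiple of x^d.
  · have key : ∀ k : ℕ, ∀ t ∈ T, ∃ u ∈ T, (p : R) • t = x ^ d • u + (p : R) • (x ^ k • c ^ k • t) := by
      intro k
      induction k with
      | zero => exact fun t ht => ⟨0, zero_mem _, by simp⟩
      | succ k ih =>
        intro t ht
        obtain ⟨u, hu, hk⟩ := ih t ht
        refine ⟨u - x ^ k • c ^ k • t, sub_mem hu (hT _ _ (hT _ _ ht)), ?_⟩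
        have := h (x ^ k • c ^ k • t) (hT _ _ (hT _ _ ht))
        rw [hk, smul_sub, this]
        simp only [smul_smul, ← add_smul, add_assoc, sub_eq_add_neg, ← neg_smul]
        congr 2
        ring
    rintro _ ⟨t, ht, rfl⟩
    obtain ⟨u, hu, hk⟩ := key d t ht
    refine ⟨u + (p : R) • (c ^ d • t), add_mem hu (hT _ _ (hT _ _ ht)), ?_⟩
    change x ^ d • _ = p • t
    rw [← Nat.cast_smul_eq_nsmul R p t, hk, smul_add]
    congr 1
    simp only [smul_smul]
    congr 1
    ring

end Action

/-- The geometric sum is the cyclotomic polynomial of order p^(j+1) at γ, and modulo p that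
polynomial is a power of X - 1. The value p at X = 1 gives the constant -1. -/
theorem exists_eisenstein {R : Type*} [CommRing R] (p : ℕ) [hp : Fact p.Prime] (j : ℕ) (γ : R) :
    ∃ c : R, (γ - 1) ^ (p ^ j * (p - 1)) =
        (p : R) * (-1 + (γ - 1) * c) + ∑ t ∈ Finset.range p, (γ ^ p ^ j) ^ t := by
  open Polynomial in
  have h1 : (C (p : ℤ)) ∣ (X - 1 : ℤ[X]) ^ (p ^ j * (p - 1)) - cyclotomic (p ^ (j + 1)) ℤ := by
    have h2 : ((X - 1 : ℤ[X]) ^ (p ^ j * (p - 1)) - cyclotomic (p ^ (j + 1)) ℤ).map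
        (Int.castRingHom (ZMod p)) = 0 := by
      have h3 := cyclotomic_mul_prime_pow_eq (ZMod p) (p := p) (m := 1)
        (by simpa using hp.out.ne_one) (k := j + 1) (by omega)
      rw [mul_one, cyclotomic_one] at h3
      have h4 : p ^ (j + 1) - p ^ (j + 1 - 1) = p ^ j * (p - 1) := by
        rw [Nat.add_sub_cancel, pow_succ, Nat.mul_sub, mul_one]
      rw [h4] at h3
      simp [h3]
    rw [C_dvd_iff_dvd_coeff]
    intro i
    rw [← ZMod.intCast_zmod_eq_zero_iff_dvd]
    have := congrArg (fun f => coeff f i) h2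
    simpa only [coeff_map, coeff_zero, eq_intCast] using this
  obtain ⟨a, ha⟩ := h1
  have h5 : a.eval 1 = -1 := by
    have := congrArg (eval 1) ha
    have hp0 : (p : ℤ) ≠ 0 := by exact_mod_cast hp.out.ne_zero
    have hq : p ^ j * (p - 1) ≠ 0 :=
      mul_ne_zero (pow_ne_zero _ hp.out.ne_zero) (Nat.sub_ne_zero_of_lt hp.out.one_lt)
    rw [cyclotomic_prime_pow_eq_geom_sum hp.out] at this
    simp only [eval_sub, eval_pow, eval_X, eval_one, sub_self, zero_pow hq, eval_finsetSum,
      one_pow, Finset.sum_const, Finset.card_range, eval_mul, eval_C] at this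
    apply mul_left_cancel₀ hp0
    rw [← this]
    simp
  obtain ⟨c, hc⟩ : (X - C 1 : ℤ[X]) ∣ a + 1 := by
    rw [dvd_iff_isRoot]
    simp [h5]
  refine ⟨aeval γ c, ?_⟩
  have h6 := congrArg (aeval γ) ha
  have h7 := congrArg (aeval γ) hc
  rw [cyclotomic_prime_pow_eq_geom_sum hp.out] at h6
  simp only [map_sub, map_pow, aeval_X, map_one, map_mul, map_sum, map_add,
    map_natCast] at h6 h7
  rw [← h7]
  linear_combination h6

/-! ### Tate cohomology of a cyclic p-group acting on a lattice. -/

section Herbrand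

variable {R E : Type*} [CommRing R] [AddCommGroup E] [Module R E]

/-- The norm element `1 + γ + ⋯ + γ ^ (k - 1)`. -/
abbrev gsum (γ : R) (k : ℕ) : R := ∑ t ∈ Finset.range k, γ ^ t

theorem gsum_mul_card (γ : R) (k l : ℕ) : gsum γ (k * l) = gsum (γ ^ k) l * gsum γ k := by
  induction l with
  | zero => simp [gsum]
  | succ l ih =>
    simp only [gsum] at ih ⊢
    rw [Nat.mul_succ, Finset.sum_range_add, ih, Finset.sum_range_succ _ l, add_mul]
    congr 1
    rw [Finset.mul_sum]
    exact Finset.sum_congr rfl fun t _ => by rw [pow_add, pow_mul]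

theorem sub_mul_gsum (γ : R) (k : ℕ) : (γ - 1) * gsum γ k = γ ^ k - 1 := mul_geom_sum γ k

/-- Each power of γ is 1 modulo γ - 1. Hence the norm is multiplication by k on fixed vectors, and k
sends the kernel of the norm into multiples of γ - 1. -/
theorem exists_gsum_eq (γ : R) (k : ℕ) : ∃ c, gsum γ k = k + (γ - 1) * c := by
  induction k with
  | zero => exact ⟨0, by simp [gsum]⟩
  | succ k ih =>
    obtain ⟨c, hc⟩ := ih
    refine ⟨c + gsum γ k, ?_⟩
    have h := sub_mul_gsum γ k
    have h2 : gsum γ (k + 1) = gsum γ k + γ ^ k := Finset.sum_range_succ _ _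
    push_cast
    linear_combination h2 + hc - h

theorem gsum_smul_of_fixed {γ : R} {x : E} (hx : (γ - 1) • x = 0) (k : ℕ) :
    gsum γ k • x = k • x := by
  obtain ⟨c, hc⟩ := exists_gsum_eq γ k
  rw [hc, add_smul, mul_comm, mul_smul, hx, smul_zero, add_zero, Nat.cast_smul_eq_nsmul]

theorem pow_sub_one_smul_of_fixed {γ : R} {x : E} (hx : (γ - 1) • x = 0) (k : ℕ) :
    (γ ^ k - 1) • x = 0 := by
  rw [← sub_mul_gsum, mul_comm, mul_smul, hx, smul_zero]

theorem pow_sub_one_smul_of_gsum {γ : R} {x : E} {k : ℕ} (hx : gsum γ k • x = 0) :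
    (γ ^ k - 1) • x = 0 := by
  rw [← sub_mul_gsum, mul_smul, hx, smul_zero]

theorem map_sub_one_ker_pow_le (γ : R) (k : ℕ) :
    (sm E (γ ^ k - 1)).ker.map (sm E (γ - 1)) ≤ (sm E (gsum γ k)).ker := by
  rintro _ ⟨x, hx, rfl⟩
  change gsum γ k • (γ - 1) • x = 0
  rw [smul_smul, mul_comm, sub_mul_gsum]
  exact hx

theorem eq_zero_of_nsmul_eq_zero [Module.Free ℤ E] {k : ℕ} (hk : k ≠ 0) {x : E} (hx : k • x = 0) : x = 0 := by
  have hx' : (k : ℤ) • x = 0 := (natCast_zsmul x k).trans hx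
  exact (smul_eq_zero.1 hx').resolve_left (by exact_mod_cast hk)

variable [Module.Free ℤ E] [Module.Finite ℤ E]

theorem finrank_ker_gsum (γ : R) {k : ℕ} (hk : k ≠ 0) :
    Module.finrank ℤ (sm E (gsum γ k)).ker + Module.finrank ℤ (sm E (γ - 1)).ker =
      Module.finrank ℤ (sm E (γ ^ k - 1)).ker := by
  rw [← finrank_map_add_finrank_ker (sm E (γ - 1)) (sm E (γ ^ k - 1)).ker]
  have h1 : (sm E (γ - 1)).ker ⊓ (sm E (γ ^ k - 1)).ker = (sm E (γ - 1)).ker :=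
    inf_eq_left.2 fun x hx => pow_sub_one_smul_of_fixed hx k
  rw [h1, finrank_eq_of_nsmul_le hk (map_sub_one_ker_pow_le γ k)]
  intro x hx
  obtain ⟨c, hc⟩ := exists_gsum_eq γ k
  refine ⟨-(c • x), ?_, ?_⟩
  · refine neg_mem ?_
    change (γ ^ k - 1) • c • x = 0
    rw [smul_comm, pow_sub_one_smul_of_gsum hx, smul_zero]
  · change (γ - 1) • -(c • x) = k • x
    have hx' : gsum γ k • x = 0 := hx
    rw [hc, add_smul, mul_smul, Nat.cast_smul_eq_nsmul] at hx'
    rw [smul_neg, eq_comm, eq_neg_iff_add_eq_zero, hx']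

variable (p : ℕ) [hp : Fact p.Prime]

/-- Here γ acts on `T` as a primitive p^(j+1)-th root of unity, and p is totally ramified in that
cyclotomic ring: with φ = p^j (p - 1), (γ - 1)^φ T = p T. The φ-th power of the index is therefore p
to the rank of `T`. -/
theorem relIndex_layer (γ : R) (s j : ℕ) (T : AddSubgroup E)
    (hT : ∀ a : R, ∀ t ∈ T, a • t ∈ T)
    (hΨ : ∀ t ∈ T, (∑ t ∈ Finset.range p, (γ ^ p ^ j) ^ t) • t = 0)
    (hr : Module.finrank ℤ T = p ^ j * (p - 1) * s) :
    (T.map (sm E (γ - 1))).relIndex T = p ^ s := by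
  have hφ : p ^ j * (p - 1) ≠ 0 :=
    mul_ne_zero (pow_ne_zero _ hp.out.ne_zero) (Nat.sub_ne_zero_of_lt hp.out.one_lt)
  obtain ⟨c, hc⟩ := exists_eisenstein p j γ
  have h1 := map_pow_eq_map_prime p (p ^ j * (p - 1)) (γ - 1) c T hT (by
    intro t ht
    rw [hc, add_smul, hΨ t ht, add_zero])
  have h2 := (relIndex_map_pow (a := γ - 1) (V := T) (by
      rintro _ ⟨t, ht, rfl⟩
      exact hT _ _ ht) (by
      intro x hx h
      have h3 := hΨ x hx
      have h4 := pow_sub_one_smul_of_fixed h (p ^ j)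
      rw [gsum_smul_of_fixed h4] at h3
      exact eq_zero_of_nsmul_eq_zero hp.out.ne_zero h3) (p ^ j * (p - 1))).2
  have : NeZero p := ⟨hp.out.ne_zero⟩
  rw [h1, relIndex_nsmul, hr, mul_comm, pow_mul] at h2
  exact (Nat.pow_left_injective hφ h2).symm

/-- The kernels of the norms of lengths 1, p, ..., p^m filter the last one, and each successive
quotient is a lattice over a cyclotomic ring. The rank hypothesis makes each contribute p^s. -/
theorem relIndex_ker_gsum (γ : R) (s m : ℕ)
    (hr : ∀ j ≤ m, Module.finrank ℤ (sm E (γ ^ p ^ j - 1)).ker + 1 = p ^ j * s) :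
    ((sm E (gsum γ (p ^ m))).ker.map (sm E (γ - 1))).relIndex (sm E (gsum γ (p ^ m))).ker =
      p ^ (m * s) := by
  induction m with
  | zero =>
    have : (sm E (gsum γ (p ^ 0))).ker = ⊥ := by
      rw [eq_bot_iff]
      intro x hx
      have hx' : gsum γ (p ^ 0) • x = 0 := hx
      simpa [gsum] using hx'
    rw [this]
    simp
  | succ j ih =>
    replace ih := ih fun i hi => hr i (by omega)
    set W := (sm E (gsum γ (p ^ j))).ker with hW
    set W' := (sm E (gsum γ (p ^ (j + 1)))).ker with hW'
    set U := W'.map (sm E (γ - 1)) with hU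
    have hmul : gsum γ (p ^ (j + 1)) = gsum (γ ^ p ^ j) p * gsum γ (p ^ j) := by
      rw [pow_succ, gsum_mul_card]
    have hWW' : W ≤ W' := by
      intro x hx
      change gsum γ (p ^ (j + 1)) • x = 0
      rw [hmul, mul_smul, show gsum γ (p ^ j) • x = 0 from hx, smul_zero]
    have hUW' : U ≤ W' := by
      rintro _ ⟨x, hx, rfl⟩
      change gsum γ (p ^ (j + 1)) • (γ - 1) • x = 0
      rw [smul_comm, show gsum γ (p ^ (j + 1)) • x = 0 from hx, smul_zero]
    rw [← AddSubgroup.relIndex_mul_relIndex U (U ⊔ W) W' le_sup_left (sup_le hUW' hWW'),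
      relIndex_sup_of_inf]
    have h1 : U ⊓ W = W.map (sm E (γ - 1)) := by
      apply le_antisymm
      · rintro _ ⟨⟨x, hx, rfl⟩, hxW⟩
        refine ⟨x, ?_, rfl⟩
        have h2 : (γ - 1) • gsum γ (p ^ j) • x = 0 := by
          rw [smul_comm]
          exact hxW
        have h3 : gsum γ (p ^ (j + 1)) • x = 0 := hx
        rw [hmul, mul_smul, gsum_smul_of_fixed (pow_sub_one_smul_of_fixed h2 _)] at h3
        exact eq_zero_of_nsmul_eq_zero hp.out.ne_zero h3
      · refine le_inf (AddSubgroup.map_mono hWW') ?_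
        rintro _ ⟨x, hx, rfl⟩
        change gsum γ (p ^ j) • (γ - 1) • x = 0
        rw [smul_comm, show gsum γ (p ^ j) • x = 0 from hx, smul_zero]
    rw [h1, ih]
    -- `T` is a copy of W'/W inside E, hence again torsion-free.
    set T := W'.map (sm E (gsum γ (p ^ j))) with hTdef
    have h2 : (U ⊔ W).relIndex W' = (T.map (sm E (γ - 1))).relIndex T := by
      rw [← relIndex_map_of_ker_inf_le (sm E (gsum γ (p ^ j))) (sup_le hUW' hWW')
        (inf_le_left.trans le_sup_right)]
      congr 1
      rw [AddSubgroup.map_sup, (AddSubgroup.map_eq_bot_iff W).2 le_rfl, sup_bot_eq, hU, hTdef,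
        ← map_sm_mul, ← map_sm_mul, mul_comm]
    rw [h2, relIndex_layer p γ s j T]
    · rw [← pow_add]
      congr 1
      ring
    · rintro a _ ⟨x, hx, rfl⟩
      refine ⟨a • x, ?_, smul_comm _ _ _⟩
      change gsum γ (p ^ (j + 1)) • a • x = 0
      rw [smul_comm, show gsum γ (p ^ (j + 1)) • x = 0 from hx, smul_zero]
    · rintro _ ⟨x, hx, rfl⟩
      have hx' : gsum γ (p ^ (j + 1)) • x = 0 := hx
      rw [hmul, mul_smul] at hx'
      exact hx'
    · have h3 := finrank_map_add_finrank_ker (sm E (gsum γ (p ^ j))) W'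
      rw [inf_eq_left.2 hWW'] at h3
      have h4 := finrank_ker_gsum (E := E) γ (pow_ne_zero j hp.out.ne_zero)
      have h5 := finrank_ker_gsum (E := E) γ (pow_ne_zero (j + 1) hp.out.ne_zero)
      have h6 := hr 0 (by omega)
      have h7 := hr j (by omega)
      have h8 := hr (j + 1) le_rfl
      rw [pow_zero, pow_one, one_mul] at h6
      obtain ⟨p', hp'⟩ : ∃ p', p = p' + 1 := ⟨p - 1, (Nat.sub_add_cancel hp.out.one_le).symm⟩
      have h9 : p ^ (j + 1) * s = p ^ j * s + p ^ j * (p - 1) * s := by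
        rw [hp', Nat.add_sub_cancel]
        ring
      rw [← hW] at h4
      rw [← hW'] at h5
      rw [← hTdef] at h3
      omega

/-- Both indices are compared with the index of `W ⊔ L` in `Λ`: applying γ - 1 kills `L`, applying
the norm kills `W`, and what remains is computed by `relIndex_ker_gsum` and by multiplication by p^m
on `L`. -/
theorem herbrand (γ : R) (s m : ℕ)
    (hr : ∀ j ≤ m, Module.finrank ℤ (sm E (γ ^ p ^ j - 1)).ker + 1 = p ^ j * s) :
    ((sm E (γ ^ p ^ m - 1)).ker.map (sm E (γ - 1))).relIndex (sm E (gsum γ (p ^ m))).ker =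
      p ^ m * ((sm E (γ ^ p ^ m - 1)).ker.map (sm E (gsum γ (p ^ m)))).relIndex
        (sm E (γ - 1)).ker ∧
    ((sm E (γ ^ p ^ m - 1)).ker.map (sm E (gsum γ (p ^ m)))).relIndex (sm E (γ - 1)).ker ≠ 0 := by
  have h1 := relIndex_ker_gsum p γ s m hr
  have hq : p ^ m ≠ 0 := pow_ne_zero m hp.out.ne_zero
  set W := (sm E (gsum γ (p ^ m))).ker with hW
  set Λ := (sm E (γ ^ p ^ m - 1)).ker with hΛ
  set L := (sm E (γ - 1)).ker with hL
  have hWΛ : W ≤ Λ := fun x hx => pow_sub_one_smul_of_gsum hx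
  have hLΛ : L ≤ Λ := fun x hx => pow_sub_one_smul_of_fixed hx _
  have hΛW : Λ.map (sm E (γ - 1)) ≤ W := map_sub_one_ker_pow_le γ _
  have hΛL : Λ.map (sm E (gsum γ (p ^ m))) ≤ L := by
    rintro _ ⟨x, hx, rfl⟩
    change (γ - 1) • gsum γ (p ^ m) • x = 0
    rw [smul_smul, sub_mul_gsum]
    exact hx
  have h2 : L.map (sm E (gsum γ (p ^ m))) = L.map (nsmulAddMonoidHom (p ^ m)) := by
    ext x
    refine exists_congr fun y => and_congr_right fun hy => ?_
    change gsum γ (p ^ m) • y = x ↔ (p ^ m) • y = x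
    rw [gsum_smul_of_fixed hy]
  have : NeZero (p ^ m) := ⟨hq⟩
  have h3 := relIndex_nsmul (p ^ m) L
  rw [← h2, ← AddSubgroup.relIndex_mul_relIndex _ _ _ (AddSubgroup.map_mono hLΛ) hΛL] at h3
  rw [← AddSubgroup.relIndex_mul_relIndex _ _ _ (AddSubgroup.map_mono hWΛ) hΛW] at h1
  have h4 : (L.map (sm E (gsum γ (p ^ m)))).relIndex (Λ.map (sm E (gsum γ (p ^ m)))) =
      (W ⊔ L).relIndex Λ := by
    rw [← relIndex_map_of_ker_inf_le (sm E (gsum γ (p ^ m))) (sup_le hWΛ hLΛ)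
        (inf_le_left.trans le_sup_left), AddSubgroup.map_sup,
        (AddSubgroup.map_eq_bot_iff W).2 le_rfl, bot_sup_eq]
  have h5 : (W.map (sm E (γ - 1))).relIndex (Λ.map (sm E (γ - 1))) =
      (W ⊔ L).relIndex Λ := by
    rw [← relIndex_map_of_ker_inf_le (sm E (γ - 1)) (sup_le hWΛ hLΛ)
        (inf_le_left.trans le_sup_right), AddSubgroup.map_sup,
        (AddSubgroup.map_eq_bot_iff L).2 le_rfl, sup_bot_eq]
  rw [h4] at h3
  rw [h5] at h1
  have h6 := hr 0 (by omega)
  rw [pow_zero, pow_one, one_mul] at h6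
  have hD : (W ⊔ L).relIndex Λ ≠ 0 := by
    intro h
    rw [h, zero_mul] at h3
    exact pow_ne_zero _ hq h3.symm
  refine ⟨mul_left_cancel₀ hD ?_, ?_⟩
  -- The fixed part has rank s - 1 rather than s; the missing rank is the factor p^m.
  · rw [h1, mul_left_comm, h3, ← h6, pow_mul]
    ring
  · intro h
    rw [h, mul_zero] at h3
    exact pow_ne_zero _ hq h3.symm

/-- The classes of `H¹` of the subgroup generated by `γ ^ p ^ m` fixed by `γ`, as elements. -/
def fixedClasses (E : Type*) [AddCommGroup E] [Module R E] (γ : R) (q k : ℕ) : AddSubgroup E :=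
  (sm E (gsum (γ ^ q) k)).ker ⊓
    ((⊤ : AddSubgroup E).map (sm E (γ ^ q - 1))).comap (sm E (γ - 1))

/-- The partial norm `gsum γ q` identifies ker(Norm)/(C ⊔ W) with (X ⊓ V)/B. The part of `X` outside
`V` is bounded by the degree 0 Tate group of `Λ`, the part of the kernel lost in `W` is the degree
-1 one, and `herbrand` trades one for the other. -/
theorem relIndex_fixedClasses_mul_le (γ : R) (s m i : ℕ) (hγ : ∀ x : E, (γ ^ p ^ (m + i)) • x = x)
    (hr : ∀ j ≤ m, Module.finrank ℤ (sm E (γ ^ p ^ j - 1)).ker + 1 = p ^ j * s)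
    (hfin : ((⊤ : AddSubgroup E).map (sm E (γ - 1))).relIndex
      (sm E (gsum γ (p ^ (m + i)))).ker ≠ 0) :
    ((⊤ : AddSubgroup E).map (sm E (γ ^ p ^ m - 1))).relIndex
        (fixedClasses E γ (p ^ m) (p ^ i)) ≠ 0 ∧
    ((⊤ : AddSubgroup E).map (sm E (γ ^ p ^ m - 1))).relIndex
        (fixedClasses E γ (p ^ m) (p ^ i)) * p ^ m ≤
      ((⊤ : AddSubgroup E).map (sm E (γ - 1))).relIndex (sm E (gsum γ (p ^ (m + i)))).ker := by
  obtain ⟨hH, hH0⟩ := herbrand (E := E) p γ s m hr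
  set q := p ^ m with hq
  set X := fixedClasses E γ q (p ^ i) with hX
  set B := (⊤ : AddSubgroup E).map (sm E (γ ^ q - 1)) with hB
  set C := (⊤ : AddSubgroup E).map (sm E (γ - 1)) with hC
  set V := (⊤ : AddSubgroup E).map (sm E (gsum γ q)) with hV
  set W := (sm E (gsum γ q)).ker with hW
  set Λ := (sm E (γ ^ q - 1)).ker with hΛ
  set L := (sm E (γ - 1)).ker with hL
  have hmul : gsum γ (p ^ (m + i)) = gsum (γ ^ q) (p ^ i) * gsum γ q := by
    rw [pow_add, gsum_mul_card]
  have hBX : B ≤ X := by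
    rintro _ ⟨x, -, rfl⟩
    refine ⟨?_, (γ - 1) • x, trivial, smul_comm _ _ _⟩
    change gsum (γ ^ q) (p ^ i) • (γ ^ q - 1) • x = 0
    rw [smul_smul, mul_comm, sub_mul_gsum, ← pow_mul, hq, ← pow_add, sub_smul, hγ, one_smul,
      sub_self]
  have hBV : B ≤ V := by
    rintro _ ⟨x, -, rfl⟩
    refine ⟨(γ - 1) • x, trivial, ?_⟩
    change gsum γ q • (γ - 1) • x = (γ ^ q - 1) • x
    rw [smul_smul, mul_comm, sub_mul_gsum]
  have hWN : W ≤ (sm E (gsum γ (p ^ (m + i)))).ker := by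
    intro x hx
    change gsum γ (p ^ (m + i)) • x = 0
    rw [hmul, mul_smul, show gsum γ q • x = 0 from hx, smul_zero]
  have hCN : C ≤ (sm E (gsum γ (p ^ (m + i)))).ker := by
    rintro _ ⟨x, -, rfl⟩
    change gsum γ (p ^ (m + i)) • (γ - 1) • x = 0
    rw [smul_smul, mul_comm, sub_mul_gsum, sub_smul, hγ, one_smul, sub_self]
  have h1 := AddSubgroup.relIndex_mul_relIndex C (C ⊔ W) _ le_sup_left (sup_le hCN hWN)
  have h2 : C ⊓ W = Λ.map (sm E (γ - 1)) := by
    apply le_antisymm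
    · rintro _ ⟨⟨x, -, rfl⟩, hx⟩
      refine ⟨x, ?_, rfl⟩
      change (γ ^ q - 1) • x = 0
      rw [← sub_mul_gsum, mul_comm, mul_smul]
      exact hx
    · exact le_inf (AddSubgroup.map_mono le_top) (map_sub_one_ker_pow_le γ q)
  rw [relIndex_sup_of_inf, h2, hH] at h1
  have h3 : B = (C ⊔ W).map (sm E (gsum γ q)) := by
    rw [AddSubgroup.map_sup, (AddSubgroup.map_eq_bot_iff W).2 le_rfl, sup_bot_eq, hC,
      ← map_sm_mul, mul_comm, sub_mul_gsum]
  have h4 : X ⊓ V = (sm E (gsum γ (p ^ (m + i)))).ker.map (sm E (gsum γ q)) := by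
    apply le_antisymm
    · rintro _ ⟨⟨hx, -⟩, y, -, rfl⟩
      refine ⟨y, ?_, rfl⟩
      change gsum γ (p ^ (m + i)) • y = 0
      rw [hmul, mul_smul]
      exact hx
    · rintro _ ⟨y, hy, rfl⟩
      refine ⟨⟨?_, y, trivial, ?_⟩, y, trivial, rfl⟩
      · change gsum (γ ^ q) (p ^ i) • gsum γ q • y = 0
        rw [smul_smul, ← hmul]
        exact hy
      · change (γ ^ q - 1) • y = (γ - 1) • gsum γ q • y
        rw [smul_smul, sub_mul_gsum]
  have h5 : B.relIndex (X ⊓ V) = (C ⊔ W).relIndex (sm E (gsum γ (p ^ (m + i)))).ker := by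
    rw [h3, h4, relIndex_map_of_ker_inf_le _ (sup_le hCN hWN) (inf_le_left.trans le_sup_right)]
  have h6 : X ≤ L ⊔ V := by
    rintro x ⟨-, y, -, hy⟩
    change (γ ^ q - 1) • y = (γ - 1) • x at hy
    rw [AddSubgroup.mem_sup]
    -- From (γ - 1)x = (γ^q - 1)y = (γ - 1)(gsum γ q)y, the difference is fixed by γ.
    refine ⟨x - gsum γ q • y, ?_, gsum γ q • y, ⟨y, trivial, rfl⟩, by abel⟩
    change (γ - 1) • (x - gsum γ q • y) = 0
    rw [smul_sub, smul_smul, sub_mul_gsum, hy, sub_self]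
  have h7 : V ⊓ L = Λ.map (sm E (gsum γ q)) := by
    apply le_antisymm
    · rintro _ ⟨⟨x, -, rfl⟩, hx⟩
      refine ⟨x, ?_, rfl⟩
      change (γ ^ q - 1) • x = 0
      rw [← sub_mul_gsum, mul_smul]
      exact hx
    · refine le_inf (AddSubgroup.map_mono le_top) ?_
      rintro _ ⟨x, hx, rfl⟩
      change (γ - 1) • gsum γ q • x = 0
      rw [smul_smul, sub_mul_gsum]
      exact hx
  have h8 : V.relIndex (L ⊔ V) = (Λ.map (sm E (gsum γ q))).relIndex L := by
    rw [AddSubgroup.relIndex_sup_right, ← AddSubgroup.inf_relIndex_right, h7]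
  have h9 : V.relIndex X ≤ (Λ.map (sm E (gsum γ q))).relIndex L := by
    rw [← h8]
    exact AddSubgroup.relIndex_le_of_le_right h6 (h8 ▸ hH0)
  have h9' : V.relIndex X ≠ 0 := fun h =>
    hH0 (h8 ▸ AddSubgroup.relIndex_eq_zero_of_le_right h6 h)
  rw [← AddSubgroup.relIndex_mul_relIndex B (X ⊓ V) X (le_inf hBX hBV) inf_le_left, h5,
    AddSubgroup.inf_relIndex_left, ← h1]
  refine ⟨mul_ne_zero ?_ h9', ?_⟩
  · intro h
    rw [h, mul_zero] at h1
    exact hfin h1.symm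
  · calc _ ≤ _ * _ * q := Nat.mul_le_mul_right _ (Nat.mul_le_mul_left _ h9)
      _ = _ := by ring

end Herbrand

/-! ### Bounding indices by maps that need not be homomorphisms. -/

section Counting

variable {E T : Type*} [AddCommGroup E]

/-- Representatives will be chosen arbitrarily, so only separation of classes is asked of `f`. Since
`relIndex` is 0 for an infinite index, its nonvanishing encodes finiteness. -/
theorem card_le_relIndex {B X : AddSubgroup E} (h0 : B.relIndex X ≠ 0) (f : T → E)
    (hf : ∀ t, f t ∈ X) (hinj : ∀ t t', f t - f t' ∈ B → t = t') :
    Finite T ∧ Nat.card T ≤ B.relIndex X := by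
  have : Finite (X ⧸ B.addSubgroupOf X) := Nat.finite_of_card_ne_zero h0
  have hF : Function.Injective fun t => (QuotientAddGroup.mk ⟨f t, hf t⟩ : X ⧸ B.addSubgroupOf X) := by
    intro t t' h
    refine (hinj t' t ?_).symm
    simpa [AddSubgroup.mem_addSubgroupOf, neg_add_eq_sub] using QuotientAddGroup.eq.1 h
  exact ⟨Finite.of_injective _ hF, Nat.card_le_card_of_injective _ hF⟩

theorem relIndex_le_card [Finite T] {B X : AddSubgroup E} (f : X → T)
    (hinj : ∀ x y, f x = f y → (x - y : E) ∈ B) :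
    B.relIndex X ≠ 0 ∧ B.relIndex X ≤ Nat.card T := by
  have hF : Function.Injective fun q : X ⧸ B.addSubgroupOf X => f q.out := by
    intro q q' h
    rw [← QuotientAddGroup.out_eq' q, ← QuotientAddGroup.out_eq' q', QuotientAddGroup.eq,
      AddSubgroup.mem_addSubgroupOf]
    have := hinj _ _ h.symm
    simpa [neg_add_eq_sub] using this
  have : Finite (X ⧸ B.addSubgroupOf X) := Finite.of_injective _ hF
  exact ⟨Nat.card_ne_zero.2 ⟨inferInstance, this⟩, Nat.card_le_card_of_injective _ hF⟩

end Counting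

/-! ### Passing between a lattice and its p-adic completion. -/

section Approximation

variable {R E M : Type*} [CommRing R] [AddCommGroup E] [AddCommGroup M] [Module R E] [Module R M]
  (ι : E →ₗ[R] M) (η : R) (k : ℕ)

theorem card_smul_of_gsum {x : M} (hx : gsum η k • x = 0) : ∃ y : M, k • x = (η - 1) • y := by
  obtain ⟨c, hc⟩ := exists_gsum_eq η k
  refine ⟨-(c • x), ?_⟩
  rw [hc, add_smul, mul_smul, Nat.cast_smul_eq_nsmul] at hx
  rw [smul_neg, eq_neg_iff_add_eq_zero, hx]

theorem exists_eq_sub_one_smul (hE : ∀ x : E, k • x = 0 → x = 0) (hηE : ∀ x : E, η ^ k • x = x)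
    (happ' : ∀ x : M, ∃ e y, x = ι e + k • y)
    (hpure : ∀ e y, ι e = k • y → ∃ e', e = k • e') {e : E} (he : gsum η k • e = 0) {y : M}
    (hy : ι e = (η - 1) • y) : ∃ e', e = (η - 1) • e' := by
  obtain ⟨e₁, y₁, rfl⟩ := happ' y
  obtain ⟨e₂, he₂⟩ := hpure (e - (η - 1) • e₁) ((η - 1) • y₁) (by
    rw [map_sub, hy, map_smul, smul_add, add_sub_cancel_left, smul_comm])
  have h1 : gsum η k • e₂ = 0 := by
    apply hE
    rw [smul_comm, ← he₂, smul_sub, he, smul_smul, mul_comm, sub_mul_gsum, sub_smul, hηE]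
    simp
  obtain ⟨e₃, he₃⟩ := card_smul_of_gsum η k h1
  exact ⟨e₃ + e₁, by rw [smul_add, ← he₃, ← he₂]; abel⟩

/-- Precision k² is needed: one factor k lets the norm k² e₁ of the approximant be cancelled by
subtracting k e₁, with e₁ fixed; the other makes the remaining error a multiple of η - 1. -/
theorem exists_approx (hE : ∀ x : E, k • x = 0 → x = 0) (hM : ∀ x : M, k • x = 0 → x = 0)
    (happ : ∀ x : M, ∃ e y, x = ι e + (k * k) • y) (hηE : ∀ x : E, η ^ k • x = x)
    (hpure : ∀ e y, ι e = (k * k) • y → ∃ e', e = (k * k) • e') {x : M}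
    (hx : gsum η k • x = 0) : ∃ e, gsum η k • e = 0 ∧ ∃ y, x - ι e = (η - 1) • y := by
  obtain ⟨e₀, y₀, rfl⟩ := happ x
  obtain ⟨e₁, he₁⟩ := hpure (gsum η k • e₀) (-(gsum η k • y₀)) (by
    rw [smul_add, smul_comm, add_eq_zero_iff_eq_neg] at hx
    rw [map_smul, hx, smul_neg])
  have h1 : (η - 1) • e₁ = 0 := by
    apply hE
    apply hE
    rw [← mul_smul, smul_comm, ← he₁, smul_smul, sub_mul_gsum, sub_smul, hηE]
    simp
  have h2 : gsum η k • (e₀ - k • e₁) = 0 := by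
    rw [smul_sub, he₁, smul_comm, gsum_smul_of_fixed h1, mul_smul, sub_self]
  refine ⟨e₀ - k • e₁, h2, ?_⟩
  have h3 : ι e₀ + (k * k) • y₀ - ι (e₀ - k • e₁) = k • (ι e₁ + k • y₀) := by
    rw [map_sub, map_nsmul, smul_add, mul_smul]
    abel
  rw [h3]
  apply card_smul_of_gsum
  apply hM
  rw [smul_comm, ← h3, smul_sub, hx, ← map_smul, h2]
  simp

end Approximation

/-! ### Cocycles on a cyclic group. -/

section CyclicCohomology

variable {k G A : Type*} [CommRing k] [Group G] [AddCommGroup A] [Module k A]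
  (ρ : Representation k G A)

theorem cocycle_pow {f : G → A} (hf : f ∈ cocycles ρ) (h : G) (n : ℕ) :
    f (h ^ n) = ∑ t ∈ Finset.range n, ρ (h ^ t) (f h) := by
  induction n with
  | zero => simpa using hf 1 1
  | succ n ih =>
    rw [pow_succ, hf, ih, Finset.sum_range_succ, add_comm]

theorem cocycle_one {f : G → A} (hf : f ∈ cocycles ρ) : f 1 = 0 := by
  simpa using hf 1 1

theorem mem_coboundaries_of_generator [Finite G] {f : G → A} (hf : f ∈ cocycles ρ) {h : G}
    (hh : ∀ x, x ∈ Subgroup.zpowers h) {a : A} (ha : f h = ρ h a - a) :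
    f ∈ coboundaries ρ := by
  refine ⟨a, ?_⟩
  funext x
  obtain ⟨n, rfl⟩ := (mem_powers_iff_mem_zpowers).2 (hh x)
  change ρ (h ^ n) a - a = f (h ^ n)
  have h1 := Finset.sum_range_sub (fun t => ρ (h ^ t) a) n
  rw [pow_zero, map_one, Module.End.one_apply] at h1
  rw [cocycle_pow ρ hf, ha, ← h1]
  refine Finset.sum_congr rfl fun t _ => ?_
  rw [map_sub, pow_succ, map_mul, Module.End.mul_apply]

end CyclicCohomology

/-! ### Invariant classes as classes in the lattice. -/

section Invariants

variable {k G A E R : Type*} [CommRing k] [Group G] [Finite G] [AddCommGroup A] [Module k A]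
  [CommRing R] [AddCommGroup E] [Module R E] [Module R A]

/-- Conjugation by `g` fixes the generator `g ^ q` of `N`, so invariance only constrains the value
there. An approximating `e` in E lies in `fixedClasses`, and two classes with congruent approximants
coincide. -/
theorem card_invariants_le (ρ : Representation k G A) (N : Subgroup G) [N.Normal] (ι : E →ₗ[R] A)
    (γ : R) (g : G) (hγ : ∀ x : A, γ • x = ρ g x) (q K : ℕ) (hN : N = Subgroup.zpowers (g ^ q))
    (hK : g ^ (q * K) = 1) (hγE : ∀ x : E, γ ^ (q * K) • x = x)
    (hE : ∀ x : E, K • x = 0 → x = 0) (hM : ∀ x : A, K • x = 0 → x = 0)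
    (happ : ∀ x : A, ∃ e y, x = ι e + (K * K) • y)
    (hpure : ∀ e y, ι e = (K * K) • y → ∃ e', e = (K * K) • e')
    (h0 : ((⊤ : AddSubgroup E).map (sm E (γ ^ q - 1))).relIndex (fixedClasses E γ q K) ≠ 0) :
    Finite (conjRep ρ N).invariants ∧ Nat.card (conjRep ρ N).invariants ≤
      ((⊤ : AddSubgroup E).map (sm E (γ ^ q - 1))).relIndex (fixedClasses E γ q K) := by
  have hhN : g ^ q ∈ N := hN ▸ Subgroup.mem_zpowers _
  let h : N := ⟨g ^ q, hhN⟩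
  have hgen : ∀ x : N, x ∈ Subgroup.zpowers h := by
    rintro ⟨x, hx⟩
    have hx' := hx
    rw [hN] at hx'
    obtain ⟨z, hz⟩ := hx'
    exact ⟨z, Subtype.ext hz⟩
  have hpow : ∀ (t : ℕ) (x : A), (γ ^ q) ^ t • x = resRep ρ N (h ^ t) x := by
    have h1 : ∀ (t : ℕ) (x : A), γ ^ t • x = ρ (g ^ t) x := by
      intro t
      induction t with
      | zero => simp
      | succ t ih => intro x; rw [pow_succ, pow_succ, mul_smul, ih, hγ, map_mul, Module.End.mul_apply]
    intro t x
    rw [← pow_mul, h1, pow_mul]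
    rfl
  have hηE : ∀ x : E, (γ ^ q) ^ K • x = x := fun x => by rw [← pow_mul, hγE]
  have key : ∀ c : (conjRep ρ N).invariants, ∃ f : cocycles (resRep ρ N), ∃ e : E,
      Submodule.Quotient.mk f = c.1 ∧ e ∈ fixedClasses E γ q K ∧
      ∃ y, f.1 h - ι e = (γ ^ q - 1) • y := by
    rintro ⟨c, hc⟩
    obtain ⟨f, rfl⟩ := Submodule.Quotient.mk_surjective _ c
    have hx : gsum (γ ^ q) K • f.1 h = 0 := by
      rw [Finset.sum_smul, Finset.sum_congr rfl fun t _ => hpow t _, ← cocycle_pow _ f.2]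
      have : h ^ K = 1 := Subtype.ext ((pow_mul g q K).symm.trans hK)
      rw [this, cocycle_one _ f.2]
    obtain ⟨e, he, y, hy⟩ := exists_approx ι (γ ^ q) K hE hM happ hηE hpure hx
    refine ⟨f, e, rfl, ⟨he, ?_⟩, y, hy⟩
    have h2 := (Representation.mem_invariants _ _).1 hc g
    have h3 : conjCocycle ρ N g f - f ∈ (coboundaries (resRep ρ N)).submoduleOf (cocycles _) :=
      (Submodule.Quotient.eq _).1 h2
    obtain ⟨z, hz⟩ := h3
    have h4 : conjInv N g h = h := by
      apply Subtype.ext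
      change g⁻¹ * g ^ q * g = g ^ q
      group
    have h5 : (γ ^ q - 1) • z = (γ - 1) • f.1 h := by
      have h6 : resRep ρ N h z - z = ρ g (f.1 (conjInv N g h)) - f.1 h := congrFun hz h
      rw [h4, ← hγ] at h6
      have h7 := hpow 1 z
      rw [pow_one, pow_one] at h7
      rw [sub_smul, sub_smul, one_smul, one_smul, h7, h6]
    obtain ⟨e', he'⟩ := exists_eq_sub_one_smul ι (γ ^ q) K hE hηE
      (fun x => by
        obtain ⟨e, y, hx⟩ := happ x
        exact ⟨e, K • y, by rw [hx, mul_smul]⟩)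
      -- Purity for K follows from purity for K² by multiplying by K and cancelling.
      (fun e y hey => by
        obtain ⟨e', he'⟩ := hpure (K • e) y (by rw [map_nsmul, hey, mul_smul])
        refine ⟨e', sub_eq_zero.1 (hE _ ?_)⟩
        rw [smul_sub, he', mul_smul, sub_self])
      (e := (γ - 1) • e) (by rw [smul_comm, he, smul_zero])
      (y := z - (γ - 1) • y) (by
        rw [smul_sub, h5, smul_comm (γ ^ q - 1) (γ - 1), ← hy, map_smul, ← smul_sub, sub_sub_cancel])
    exact ⟨e', trivial, he'.symm⟩
  choose f e hf he hfe using key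
  refine card_le_relIndex h0 e he ?_
  rintro c c' ⟨z, -, hz⟩
  obtain ⟨y, hy⟩ := hfe c
  obtain ⟨y', hy'⟩ := hfe c'
  apply Subtype.ext
  rw [← hf c, ← hf c', Submodule.Quotient.eq]
  refine mem_coboundaries_of_generator (resRep ρ N) (f c - f c').2 hgen (a := y - y' + ι z) ?_
  have h7 := hpow 1 (y - y' + ι z)
  rw [pow_one, pow_one] at h7
  rw [← h7]
  change (f c).1 h - (f c').1 h = _
  change (γ ^ q - 1) • z = e c - e c' at hz
  have h8 : (γ ^ q - 1) • (y - y' + ι z) = (f c).1 h - (f c').1 h := by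
    rw [smul_add, smul_sub, ← hy, ← hy', ← map_smul, hz, map_sub]
    abel
  rw [← h8, sub_smul, one_smul]

end Invariants

/-! ### Density and purity of E in ℤ_p ⊗ E. -/

section PadicTensor

variable (p : ℕ) [hp : Fact p.Prime] {E : Type*} [AddCommGroup E]

theorem exists_tensor_approx (k : ℕ) (x : ℤ_[p] ⊗[ℤ] E) :
    ∃ (e : E) (y : ℤ_[p] ⊗[ℤ] E), x = 1 ⊗ₜ e + p ^ k • y := by
  induction x using TensorProduct.induction_on with
  | zero => exact ⟨0, 0, by simp⟩
  | tmul z e =>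
    obtain ⟨w, hw⟩ := Ideal.mem_span_singleton.1 (PadicInt.appr_spec k z)
    refine ⟨z.appr k • e, w ⊗ₜ e, ?_⟩
    rw [TensorProduct.tmul_smul, TensorProduct.smul_tmul', TensorProduct.smul_tmul',
      ← TensorProduct.add_tmul]
    congr 1
    rw [nsmul_eq_mul, nsmul_eq_mul, mul_one, Nat.cast_pow, ← hw]
    ring
  | add x y hx hy =>
    obtain ⟨e, x', rfl⟩ := hx
    obtain ⟨e', y', rfl⟩ := hy
    refine ⟨e + e', x' + y', ?_⟩
    rw [TensorProduct.tmul_add, smul_add]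
    abel

theorem exists_eq_pow_smul_of_tensor [Module.Free ℤ E] (k : ℕ) (e : E) (y : ℤ_[p] ⊗[ℤ] E)
    (h : (1 : ℤ_[p]) ⊗ₜ e = p ^ k • y) : ∃ e', e = p ^ k • e' := by
  let b := Module.Free.chooseBasis ℤ E
  let B := Algebra.TensorProduct.basis ℤ_[p] b
  have h1 : ∀ i, ((p : ℤ) ^ k) ∣ b.repr e i := by
    intro i
    rw [← PadicInt.pow_p_dvd_int_iff]
    have h2 := congrArg (fun z => B.repr z i) h
    simp only [B, Algebra.TensorProduct.basis_repr_tmul, map_nsmul] at h2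
    refine ⟨B.repr y i, ?_⟩
    simpa [B] using h2
  choose c hc using h1
  have hp0 : ((p : ℤ) ^ k) ≠ 0 := pow_ne_zero _ (by exact_mod_cast hp.out.ne_zero)
  let c' : Module.Free.ChooseBasisIndex ℤ E →₀ ℤ :=
    Finsupp.onFinset (b.repr e).support c fun i hi => by
      rw [Finsupp.mem_support_iff, hc i]
      exact mul_ne_zero hp0 hi
  refine ⟨b.repr.symm c', b.repr.injective ?_⟩
  ext i
  rw [map_nsmul, LinearEquiv.apply_symm_apply]
  simpa [c'] using hc i

theorem eq_zero_of_nsmul_tensor [Module.Free ℤ E] (k : ℕ) (y : ℤ_[p] ⊗[ℤ] E)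
    (h : p ^ k • y = 0) : y = 0 := by
  rw [← Nat.cast_smul_eq_nsmul ℤ_[p]] at h
  refine (smul_eq_zero.1 h).resolve_left ?_
  exact_mod_cast pow_ne_zero k hp.out.ne_zero

end PadicTensor

/-! ### Ranks of fixed units. -/

section UnitRanks

open NumberField

instance (F : Type*) [Field F] [NumberField F] : Module.Free ℤ (Additive (UnitsModTorsion F)) :=
  Module.Free.of_basis (NumberField.Units.basisModTorsion F)

instance (F : Type*) [Field F] [NumberField F] : Module.Finite ℤ (Additive (UnitsModTorsion F)) :=
  Module.Finite.of_basis (NumberField.Units.basisModTorsion F)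

/-- The class of a unit modulo torsion, in additive notation. -/
noncomputable def unitClass (F : Type*) [Field F] : Additive (𝓞 F)ˣ →+ Additive (UnitsModTorsion F) :=
  MonoidHom.toAdditive (QuotientGroup.mk' (NumberField.Units.torsion F))

theorem unitClass_surjective (F : Type*) [Field F] : Function.Surjective (unitClass F) :=
  QuotientGroup.mk'_surjective (NumberField.Units.torsion F)

theorem unitClass_eq_zero_iff {F : Type*} [Field F] (u : (𝓞 F)ˣ) :
    unitClass F (Additive.ofMul u) = 0 ↔ u ∈ NumberField.Units.torsion F :=
  QuotientGroup.eq_one_iff (N := NumberField.Units.torsion F) u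

variable (L F : Type*) [Field L] [Field F] [Algebra L F]

theorem unitsRep_unitClass (σ : Gal(F/L)) (u : (𝓞 F)ˣ) :
    unitsRep L F σ (unitClass F (Additive.ofMul u)) =
      unitClass F (Additive.ofMul (galUnits L F σ u)) := rfl

theorem finrank_ker_unitClass_comp [NumberField F] (K : IntermediateField L F) [NumberField K] :
    Module.finrank ℤ ((⊤ : AddSubgroup (Additive (𝓞 K)ˣ)).map ((unitClass F).comp
      (MonoidHom.toAdditive (Units.map (algebraMap (𝓞 K) (𝓞 F)).toMonoidHom)))) =
      NumberField.Units.rank K := by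
  set φ := (unitClass F).comp
      (MonoidHom.toAdditive (Units.map (algebraMap (𝓞 K) (𝓞 F)).toMonoidHom)) with hφ
  have h := finrank_map_add_finrank_ker φ ⊤
  have h1 : Module.finrank ℤ (φ.ker ⊓ ⊤ : AddSubgroup (Additive (𝓞 K)ˣ)) = 0 := by
    rw [Module.finrank_eq_zero_iff_isTorsion]
    rintro ⟨x, hx, -⟩
    have hx' : Units.map (algebraMap (𝓞 K) (𝓞 F)).toMonoidHom x.toMul ∈
        NumberField.Units.torsion F := (unitClass_eq_zero_iff _).1 hx
    obtain ⟨m, hm, hpow⟩ := isOfFinOrder_iff_pow_eq_one.1 ((CommGroup.mem_torsion _).1 hx')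
    have h3 : x.toMul ^ m = 1 := by
      have hinj : Function.Injective (Units.map (algebraMap (𝓞 K) (𝓞 F)).toMonoidHom) :=
        Units.map_injective (FaithfulSMul.algebraMap_injective (𝓞 K) (𝓞 F))
      exact hinj (by rw [map_pow, map_one]; exact hpow)
    refine ⟨⟨m, mem_nonZeroDivisors_of_ne_zero (by exact_mod_cast hm.ne')⟩, Subtype.ext ?_⟩
    change (m : ℤ) • x = 0
    rw [natCast_zsmul]
    exact h3
  have h2 : Module.finrank ℤ (⊤ : AddSubgroup (Additive (𝓞 K)ˣ)) = NumberField.Units.rank K := by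
    rw [← NumberField.Units.finrank_eq]
    exact (AddSubgroup.topEquiv.toIntLinearEquiv).finrank_eq
  rw [h1, h2, add_zero] at h
  exact h

theorem finrank_fixed_units [NumberField L] [NumberField F] [IsGalois L F] (σ : Gal(F/L)) :
    Module.finrank ℤ ((unitsRep L F σ).toAddMonoidHom - AddMonoidHom.id _).ker =
      NumberField.Units.rank (IntermediateField.fixedField (Subgroup.zpowers σ)) := by
  rw [← finrank_ker_unitClass_comp L F]
  symm
  -- If the class of u is fixed, then σ(u)/u is a root of unity, so u to the power of the torsion
  -- order is fixed by σ and lies in the fixed field.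
  refine finrank_eq_of_nsmul_le (NumberField.Units.torsionOrder_ne_zero F) ?_ ?_
  · rintro _ ⟨x, -, rfl⟩
    refine sub_eq_zero.2 ?_
    refine congrArg (fun u => unitClass F (Additive.ofMul u)) (Units.ext (RingOfIntegers.ext ?_))
    exact ((x.toMul : (𝓞 (IntermediateField.fixedField (Subgroup.zpowers σ)))ˣ) :
      𝓞 (IntermediateField.fixedField (Subgroup.zpowers σ))).1.2 ⟨σ, Subgroup.mem_zpowers σ⟩
  · intro x hx
    obtain ⟨u, rfl⟩ := unitClass_surjective F x
    set w := u.toMul with hw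
    set k := NumberField.Units.torsionOrder F
    have h1 : galUnits L F σ w * w⁻¹ ∈ NumberField.Units.torsion F :=
      (unitClass_eq_zero_iff _).1 hx
    have h2 : galUnits L F σ (w ^ k) = w ^ k := by
      have h3 : (galUnits L F σ w * w⁻¹) ^ k = 1 := by
        have h4 := pow_card_eq_one' (x := (⟨_, h1⟩ : NumberField.Units.torsion F))
        exact congrArg Subtype.val h4
      rw [mul_pow, inv_pow, mul_inv_eq_one] at h3
      rw [map_pow, h3]
    have hfix : ∀ y : F, σ y = y → y ∈ IntermediateField.fixedField (Subgroup.zpowers σ) := by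
      rintro y hy ⟨τ, hτ⟩
      have h5 : Subgroup.zpowers σ ≤ MulAction.stabilizer Gal(F/L) y :=
        (Subgroup.zpowers_le).2 hy
      exact h5 hτ
    have h6 : ∀ v : (𝓞 F)ˣ, galUnits L F σ v = v →
        ∃ z : 𝓞 (IntermediateField.fixedField (Subgroup.zpowers σ)),
          algebraMap _ (𝓞 F) z = (v : 𝓞 F) := by
      intro v hv
      refine ⟨⟨⟨((v : 𝓞 F) : F), hfix _ (congrArg (fun t : (𝓞 F)ˣ => ((t : 𝓞 F) : F)) hv)⟩, ?_⟩, ?_⟩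
      · have h7 := RingOfIntegers.isIntegral_coe (v : 𝓞 F)
        exact (isIntegral_algHom_iff
          ((IntermediateField.fixedField (Subgroup.zpowers σ)).val.restrictScalars ℤ)
          Subtype.val_injective).1 h7
      · rfl
    obtain ⟨z, hz⟩ := h6 _ h2
    obtain ⟨z', hz'⟩ := h6 (w ^ k)⁻¹ (by rw [map_inv, h2])
    have hinj := FaithfulSMul.algebraMap_injective
      (𝓞 (IntermediateField.fixedField (Subgroup.zpowers σ))) (𝓞 F)
    refine ⟨Additive.ofMul ⟨z, z', hinj ?_, hinj ?_⟩, trivial, ?_⟩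
    · rw [map_mul, hz, hz', map_one, ← Units.val_mul, mul_inv_cancel, Units.val_one]
    · rw [map_mul, hz, hz', map_one, ← Units.val_mul, inv_mul_cancel, Units.val_one]
    · rw [← map_nsmul]
      exact congrArg (fun u => unitClass F (Additive.ofMul u)) (Units.ext hz)

theorem rank_fixedField_add_one (p : ℕ) [hp : Fact p.Prime] (hp2 : p ≠ 2) [NumberField L]
    [NumberField F] [IsGalois L F] [IsCyclic Gal(F/L)] {n : ℕ} (hn : Module.finrank L F = p ^ n)
    (g : Gal(F/L)) (hg : ∀ x, x ∈ Subgroup.zpowers g) {j : ℕ} (hj : j ≤ n) :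
    NumberField.Units.rank (IntermediateField.fixedField (Subgroup.zpowers (g ^ p ^ j))) + 1 =
      p ^ j * Fintype.card (InfinitePlace L) := by
  have hcard : orderOf g = p ^ n := by
    rw [orderOf_eq_card_of_forall_mem_zpowers hg, IsGalois.card_aut_eq_finrank, hn]
  set H := Subgroup.zpowers (g ^ p ^ j)
  have hH : Nat.card H = p ^ (n - j) := by
    rw [Nat.card_zpowers, orderOf_pow_of_dvd (pow_ne_zero _ hp.out.ne_zero)
      (hcard ▸ pow_dvd_pow p hj), hcard, Nat.pow_div hj hp.out.pos]
  have : IsMulCommutative Gal(F/L) := inferInstance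
  have hN : H.Normal := inferInstance
  set K := IntermediateField.fixedField H
  have : IsGalois L K := inferInstance
  have h1 : Module.finrank K F = p ^ (n - j) := by
    rw [IntermediateField.finrank_fixedField_eq_card, hH]
  have h2 : Module.finrank L K = p ^ j := by
    have := Module.finrank_mul_finrank L K F
    rw [h1, hn, ← Nat.add_sub_of_le hj, pow_add, Nat.add_sub_cancel_left] at this
    exact Nat.eq_of_mul_eq_mul_right (pow_pos hp.out.pos _) this
  have : IsUnramifiedAtInfinitePlaces L K := IsUnramifiedAtInfinitePlaces_of_odd_finrank
    (h2 ▸ (hp.out.odd_of_ne_two hp2).pow)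
  have h3 := IsUnramifiedAtInfinitePlaces.card_infinitePlace L K
  have h4 : 0 < Fintype.card (InfinitePlace K) := Fintype.card_pos
  rw [NumberField.Units.rank, Nat.sub_add_cancel h4, h3, h2, mul_comm]

end UnitRanks
-- Hilbert 90 for cyclic extensions.
section HilbertNinety

variable {K L : Type*} [Field K] [Field L] [Algebra K L] [FiniteDimensional K L]

/-- Hilbert's Theorem 90 for cyclic extensions in any universe. -/
theorem exists_apply_eq_mul_of_prod_eq_one {g : Gal(L/K)} (hg : ∀ x, x ∈ Subgroup.zpowers g)
    (u : Lˣ) (hu : ∏ t ∈ Finset.range (orderOf g), (g ^ t) • u = 1) :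
    ∃ a : Lˣ, g • a = u * a := by
  set P : ℕ → Lˣ := fun k => ∏ t ∈ Finset.range k, (g ^ t) • u with hP
  have hadd : ∀ a b, P (a + b) = P a * (g ^ a) • P b := by
    intro a b
    simp only [hP, Finset.prod_range_add, Finset.smul_prod', smul_smul, ← pow_add]
  have hper : Function.Periodic P (orderOf g) := fun a => by
    rw [hadd, show P (orderOf g) = 1 from hu, smul_one, mul_one]
  -- Norm one makes the partial products periodic, so they define a cocycle on the group.
  have hmod : ∀ a b, g ^ a = g ^ b → P a = P b := by
    intro a b h
    rw [← hper.map_mod_nat a, ← hper.map_mod_nat b, pow_inj_mod.1 h]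
  choose e he using fun x => mem_powers_iff_mem_zpowers.2 (hg x)
  obtain ⟨β, hβ⟩ := groupCohomology.isMulCoboundary₁_of_isMulCocycle₁_of_aut_to_units
    (fun σ => P (e σ)) (by
      intro σ τ
      have h1 : P (e (σ * τ)) = P (e σ + e τ) := hmod _ _ (by
        rw [pow_add]
        exact (he _).trans (congrArg₂ (· * ·) (he σ).symm (he τ).symm))
      have h2 : g ^ e σ = σ := he σ
      change P (e (σ * τ)) = σ • P (e τ) * P (e σ)
      rw [h1, hadd, h2, mul_comm])
  refine ⟨β, ?_⟩
  have h3 : P (e g) = u := by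
    rw [hmod (e g) 1 ((he g).trans (pow_one g).symm)]
    rw [hP]
    simp only [Finset.prod_range_one, pow_zero, one_smul]
  have h4 : g • β / β = P (e g) := hβ g
  rw [h3] at h4
  rw [← h4, div_mul_cancel]

end HilbertNinety

/-! ### Invariant ideals extended from the base. -/

section Extended

open scoped Pointwise

variable {A B : Type*} [CommRing A] [CommRing B] [IsDedekindDomain A] [IsDedekindDomain B]
  [Algebra A B] [Module.IsTorsionFree A B] [FaithfulSMul A B] [Algebra.IsIntegral A B]

theorem emultiplicity_map_eq_ramificationIdx_mul_under {P : Ideal B} [P.IsPrime] (hP : P ≠ ⊥)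
    {I : Ideal A} (hI : I ≠ ⊥) : emultiplicity P (I.map (algebraMap A B)) =
      P.ramificationIdx A * emultiplicity (P.under A) I := by
  have hv : P.under A ≠ ⊥ := mt Ideal.eq_bot_of_comap_eq_bot hP
  rw [Ideal.IsDedekindDomain.emultiplicity_map_eq_ramificationIdx'_mul (v := P.under A) hI
    (Ideal.prime_of_isPrime hv inferInstance).irreducible
    (Ideal.prime_of_isPrime hP inferInstance).irreducible hP,
    Ideal.ramificationIdx'_eq_ramificationIdx _ _ hv]

variable (G : Type*) [Group G] [Finite G] [MulSemiringAction G B] [IsGaloisGroup G A B]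

/-- An ideal invariant under the Galois group whose multiplicities are divisible by the ramification
indices is extended from the base. -/
theorem exists_map_eq_of_invariant (J : Ideal B) (hJ0 : J ≠ ⊥) (hJ : ∀ σ : G, σ • J = J)
    (hmult : ∀ P : Ideal B, P.IsPrime → P ≠ ⊥ →
      ∃ k : ℕ, emultiplicity P J = P.ramificationIdx A * (k : ℕ∞)) :
    ∃ I : Ideal A, I.map (algebraMap A B) = J := by
  induction J using WellFoundedGT.induction with
  | ind J ih =>
  by_cases htop : J = ⊤
  · exact ⟨⊤, by rw [htop, Ideal.map_top]⟩
  obtain ⟨P, hPmax, hPJ⟩ := Ideal.exists_le_maximal J htop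
  have hPp := hPmax.isPrime
  have hP0 : P ≠ ⊥ := fun h => hJ0 (le_bot_iff.1 (h ▸ hPJ))
  set v := P.under A with hv
  have hv0 : v ≠ ⊥ := mt Ideal.eq_bot_of_comap_eq_bot hP0
  have hvp : Prime v := Ideal.prime_of_isPrime hv0 inferInstance
  have hvm0 : v.map (algebraMap A B) ≠ ⊥ := Ideal.map_ne_bot_of_ne_bot hv0
  -- All primes above v are conjugate, so by invariance each divides J, hence with multiplicity at
  -- least its ramification index. Dividing by v B enlarges J, which drives the induction.
  have hdvd : v.map (algebraMap A B) ∣ J := by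
    rw [UniqueFactorizationMonoid.dvd_iff_emultiplicity_le hvm0]
    intro Q hQ
    have hQp := Ideal.isPrime_of_prime hQ
    have hQ0 : Q ≠ ⊥ := hQ.ne_zero
    have hu0 : Q.under A ≠ ⊥ := mt Ideal.eq_bot_of_comap_eq_bot hQ0
    have hup : Prime (Q.under A) := Ideal.prime_of_isPrime hu0 inferInstance
    rw [emultiplicity_map_eq_ramificationIdx_mul_under hQ0 hv0]
    by_cases hQv : Q.under A = v
    · rw [hQv, (FiniteMultiplicity.of_prime_left hvp hv0).emultiplicity_self, mul_one]
      obtain ⟨k, hk⟩ := hmult Q hQp hQ0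
      obtain ⟨σ, hσ⟩ := Algebra.IsInvariant.exists_smul_of_under_eq A B G P Q hQv.symm
      have hQJ : Q ∣ J := by
        rw [Ideal.dvd_iff_le, hσ, ← hJ σ]
        exact Ideal.pointwise_smul_le_pointwise_smul_iff.2 hPJ
      have hk0 : k ≠ 0 := by
        rintro rfl
        rw [Nat.cast_zero, mul_zero, emultiplicity_eq_zero] at hk
        exact hk hQJ
      rw [hk]
      exact_mod_cast Nat.le_mul_of_pos_right _ (Nat.pos_of_ne_zero hk0)
    · rw [emultiplicity_eq_zero.2, mul_zero]
      · exact zero_le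
      · intro h
        exact hQv (associated_iff_eq.1 ((hup.dvd_prime_iff_associated hvp).1 h))
  obtain ⟨J', rfl⟩ := hdvd
  have hJ'0 : J' ≠ ⊥ := fun h => hJ0 (by rw [h, Ideal.mul_bot])
  have hsm : ∀ σ : G, σ • v.map (algebraMap A B) = v.map (algebraMap A B) := by
    intro σ
    have : SMulCommClass G A B := IsGaloisGroup.commutes
    rw [Ideal.pointwise_smul_def, Ideal.map_map]
    congr 1
    ext x
    exact smul_algebraMap σ x
  obtain ⟨I, hI⟩ := ih J' (lt_of_le_of_ne Ideal.mul_le_right (by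
      intro h
      have : v.map (algebraMap A B) = ⊤ := by
        have h1 : v.map (algebraMap A B) * J' = ⊤ * J' := by rw [h, Ideal.top_mul]
        exact mul_right_cancel₀ hJ'0 h1
      exact hPp.ne_top (top_le_iff.1 (this ▸ Ideal.map_comap_le)))) hJ'0 (by
      intro σ
      have h1 := hJ σ
      rw [smul_mul', hsm] at h1
      exact mul_left_cancel₀ hvm0 h1) (by
      intro Q hQp hQ0
      obtain ⟨k, hk⟩ := hmult Q hQp hQ0
      have hQ := Ideal.prime_of_isPrime hQ0 hQp
      have hu0 : Q.under A ≠ ⊥ := mt Ideal.eq_bot_of_comap_eq_bot hQ0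
      have hup : Prime (Q.under A) := Ideal.prime_of_isPrime hu0 inferInstance
      rw [emultiplicity_mul hQ, emultiplicity_map_eq_ramificationIdx_mul_under hQ0 hv0,
        (FiniteMultiplicity.of_prime_left hup hv0).emultiplicity_eq_multiplicity,
        (FiniteMultiplicity.of_prime_left hQ hJ'0).emultiplicity_eq_multiplicity] at hk
      refine ⟨k - multiplicity (Q.under A) v, ?_⟩
      rw [(FiniteMultiplicity.of_prime_left hQ hJ'0).emultiplicity_eq_multiplicity]
      norm_cast at hk ⊢
      rw [Nat.mul_sub, ← hk, Nat.add_sub_cancel_left])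
  exact ⟨v * I, by rw [Ideal.map_mul, hI]⟩

end Extended

/-! ### p-power torsion of a finite abelian group. -/

section Torsion

theorem card_ker_nsmul_pow_le (p : ℕ) [hp : Fact p.Prime] (C : Type*) [AddCommGroup C] [Finite C]
    (k : ℕ) : Nat.card (nsmulAddMonoidHom (α := C) (p ^ k)).ker ≤
      p ^ (k * Module.finrank (ZMod p) (ModN C p)) := by
  have h1 : Nat.card (nsmulAddMonoidHom (α := C) p).ker = 
      p ^ Module.finrank (ZMod p) (ModN C p) := by
    have h2 : Nat.card (ModN C p) = (nsmulAddMonoidHom (α := C) p).range.index := by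
      refine Nat.card_congr (QuotientAddGroup.quotientAddEquivOfEq (M := Submodule.toAddSubgroup _) ?_).toEquiv
      ext x
      simp
    have : Finite (ModN C p) := Quotient.finite _
    have h3 := Module.natCard_eq_pow_finrank (K := ZMod p) (V := ModN C p)
    rw [Nat.card_zmod, h2, AddSubgroup.index_range] at h3
    exact h3
  induction k with
  | zero =>
    rw [zero_mul, pow_zero]
    refine Finite.card_le_one_iff_subsingleton.2 ⟨fun x y => Subtype.ext ?_⟩
    have hx : p ^ 0 • x.1 = 0 := x.2
    have hy : p ^ 0 • y.1 = 0 := y.2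
    rw [pow_zero, one_smul] at hx hy
    rw [hx, hy]
  | succ k ih =>
    set V := (nsmulAddMonoidHom (α := C) (p ^ (k + 1))).ker
    have hle : (nsmulAddMonoidHom (α := C) p).ker ≤ V := fun x hx => by
      change p ^ (k + 1) • x = 0
      rw [pow_succ, mul_smul, show p • x = 0 from hx, smul_zero]
    have hmap : V.map (nsmulAddMonoidHom (α := C) p) ≤ (nsmulAddMonoidHom (α := C) (p ^ k)).ker := by
      rintro _ ⟨x, hx, rfl⟩
      change p ^ k • p • x = 0
      rw [smul_smul, ← pow_succ]
      exact hx
    rw [← AddSubgroup.relIndex_bot_left, ← AddSubgroup.relIndex_mul_relIndex ⊥ _ V bot_le hle,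
      AddSubgroup.relIndex_bot_left, AddSubgroup.relIndex_ker, h1, add_mul, one_mul, pow_add, mul_comm]
    exact Nat.mul_le_mul_right _ ((Nat.card_mono (Set.toFinite _) hmap).trans ih)

end Torsion

/-! ### Ramification, valuations and ideal classes. -/

section ClassGroupBound

open NumberField IsDedekindDomain

variable (L F : Type*) [Field L] [NumberField L] [Field F] [NumberField F] [Algebra L F]

theorem ramificationIdx_eq_one_of_not_dvd_different (P : Ideal (𝓞 F)) [P.IsPrime]
    (h : ¬ P ∣ differentIdeal (𝓞 L) (𝓞 F)) : P.ramificationIdx (𝓞 L) = 1 := by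
  let _ : Algebra (FractionRing (𝓞 L)) (FractionRing (𝓞 F)) := FractionRing.liftAlgebra _ _
  have := (not_dvd_differentIdeal_iff (A := 𝓞 L)).1 h
  exact Ideal.ramificationIdx_eq_one P (𝓞 L)

theorem finite_ramifiedPrimes : (ramifiedPrimes L F).Finite := by
  let _ : Algebra (FractionRing (𝓞 L)) (FractionRing (𝓞 F)) := FractionRing.liftAlgebra _ _
  have h0 : differentIdeal (𝓞 L) (𝓞 F) ≠ ⊥ := differentIdeal_ne_bot
  have hfin : {P : Ideal (𝓞 F) | P ∣ differentIdeal (𝓞 L) (𝓞 F)}.Finite := by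
    let _ : Fintype {P : Ideal (𝓞 F) | P ∣ differentIdeal (𝓞 L) (𝓞 F)} :=
      UniqueFactorizationMonoid.fintypeSubtypeDvd (differentIdeal (𝓞 L) (𝓞 F)) h0
    exact Set.toFinite _
  refine Set.Finite.of_finite_image (f := HeightOneSpectrum.asIdeal)
    ((hfin.image (Ideal.under (𝓞 L))).subset ?_) (fun _ _ _ _ h => HeightOneSpectrum.ext h)
  rintro _ ⟨v, ⟨P, hP, hPv, hram⟩, rfl⟩
  exact ⟨P, not_not.1 fun h => hram (ramificationIdx_eq_one_of_not_dvd_different L F P h),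
    hPv.over.symm⟩

theorem ramificationIdx_dvd_finrank [IsGalois L F] (P : Ideal (𝓞 F)) [P.IsPrime] :
    P.ramificationIdx (𝓞 L) ∣ Module.finrank L F := by
  have h := Ideal.ncard_primesOver_mul_ramificationIdxIn_mul_inertiaDegIn (P.under (𝓞 L))
    (𝓞 F) Gal(F/L)
  rw [Ideal.ramificationIdxIn_eq_ramificationIdx (P.under (𝓞 L)) P Gal(F/L),
    IsGalois.card_aut_eq_finrank] at h
  exact ⟨_, by rw [← h, mul_left_comm]⟩

variable {L F}

/-- A prime of `F` above a ramified prime of `L`. -/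
noncomputable def primeAbove (v : ramifiedPrimes L F) : HeightOneSpectrum (𝓞 F) where
  asIdeal := v.2.choose
  isPrime := v.2.choose_spec.1
  ne_bot := by
    have := v.2.choose_spec.2.1
    exact Ideal.ne_bot_of_liesOver_of_ne_bot v.1.ne_bot _

theorem primeAbove_under (v : ramifiedPrimes L F) :
    (primeAbove v).asIdeal.under (𝓞 L) = v.1.asIdeal :=
  v.2.choose_spec.2.1.over.symm

/-- The valuations at the chosen primes above the ramified primes, modulo `N`. -/
noncomputable def ramifiedVal (L F : Type*) [Field L] [NumberField L] [Field F] [NumberField F]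
    [Algebra L F] (N : ℕ) :
    Fˣ →* (ramifiedPrimes L F → Multiplicative (ZMod N)) :=
  MonoidHom.pi fun v =>
    (AddMonoidHom.toMultiplicative (Int.castAddHom (ZMod N))).comp
      (primeAbove v).valuationOfNeZero

theorem ramifiedVal_eq_one_iff {N : ℕ} (a : Fˣ) : ramifiedVal L F N a = 1 ↔
    ∀ v : ramifiedPrimes L F, (N : ℤ) ∣ ((primeAbove v).valuationOfNeZero a).toAdd := by
  rw [funext_iff]
  refine forall_congr' fun v => ?_
  exact ZMod.intCast_zmod_eq_zero_iff_dvd _ _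

theorem valuationOfNeZero_toAdd_of_integral (P : HeightOneSpectrum (𝓞 F)) (a : Fˣ) (x : 𝓞 F)
    (hx : (x : F) = a) :
    (P.valuationOfNeZero a).toAdd = -(multiplicity P.asIdeal (Ideal.span {x}) : ℤ) := by
  have hx0 : x ≠ 0 := by
    rintro rfl
    exact a.ne_zero hx.symm
  have h1 := P.valuationOfNeZero_eq a
  rw [← hx, P.valuation_of_algebraMap, P.intValuation_eq_exp_neg_multiplicity hx0] at h1
  exact congrArg Multiplicative.toAdd (WithZero.coe_inj.1 h1)

theorem multiplicity_primeAbove_dvd {N : ℕ} (x : 𝓞 F) (a : Fˣ) (hx : (x : F) = a)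
    (ha : ramifiedVal L F N a = 1) (v : ramifiedPrimes L F) :
    N ∣ multiplicity (primeAbove v).asIdeal (Ideal.span {x}) := by
  have h := (ramifiedVal_eq_one_iff a).1 ha v
  rw [valuationOfNeZero_toAdd_of_integral _ a x hx, dvd_neg] at h
  exact_mod_cast h

-- Conjugate primes have equal multiplicity in an invariant ideal, so one prime above each ramified
-- prime is enough to test. Divisibility by the degree suffices because ramification indices divide
-- it.
open scoped Pointwise in
theorem exists_map_eq_span [IsGalois L F] {N : ℕ} (hN : Module.finrank L F = N) {x : 𝓞 F} (hx0 : x ≠ 0)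
    (hinv : ∀ σ : Gal(F/L), σ • (Ideal.span {x}) = Ideal.span {x})
    (hx : ∀ v : ramifiedPrimes L F,
      N ∣ multiplicity (primeAbove v).asIdeal (Ideal.span {x})) :
    ∃ I : Ideal (𝓞 L), I.map (algebraMap (𝓞 L) (𝓞 F)) = Ideal.span {x} := by
  have hJ0 : Ideal.span {x} ≠ ⊥ := by rwa [Ne, Ideal.span_singleton_eq_bot]
  refine exists_map_eq_of_invariant Gal(F/L) _ hJ0 hinv fun P hP hP0 => ?_
  have hPp := Ideal.prime_of_isPrime hP0 hP
  have hdvd : P.ramificationIdx (𝓞 L) ∣ multiplicity P (Ideal.span {x}) := by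
    by_cases he : P.ramificationIdx (𝓞 L) = 1
    · rw [he]
      exact one_dvd _
    let v : ramifiedPrimes L F := ⟨⟨P.under (𝓞 L), inferInstance,
      mt Ideal.eq_bot_of_comap_eq_bot hP0⟩, P, hP, ⟨rfl⟩, he⟩
    have := (primeAbove v).isPrime
    obtain ⟨σ, hσ⟩ := Algebra.IsInvariant.exists_smul_of_under_eq (𝓞 L) (𝓞 F) Gal(F/L)
      (primeAbove v).asIdeal P (primeAbove_under v)
    have h1 : multiplicity P (Ideal.span {x}) =
        multiplicity (primeAbove v).asIdeal (Ideal.span {x}) := by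
      apply multiplicity_eq_of_emultiplicity_eq
      conv_lhs => rw [hσ, ← hinv σ]
      exact emultiplicity_map_eq (MulDistribMulAction.toMulEquiv (Ideal (𝓞 F)) σ)
    rw [h1]
    exact (hN ▸ ramificationIdx_dvd_finrank L F P).trans (hx v)
  obtain ⟨k, hk⟩ := hdvd
  refine ⟨k, ?_⟩
  rw [(FiniteMultiplicity.of_prime_left hPp hJ0).emultiplicity_eq_multiplicity, hk, Nat.cast_mul]

/-- The relative norm of an extended ideal is its power by the degree, and the norm of a principal
ideal is principal. -/
theorem isPrincipal_pow_of_map_eq_span {I : Ideal (𝓞 L)} {x : 𝓞 F}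
    (h : I.map (algebraMap (𝓞 L) (𝓞 F)) = Ideal.span {x}) :
    (I ^ Module.finrank L F).IsPrincipal := by
  have h1 := Ideal.relNorm_algebraMap (𝓞 F) I
  rw [h, Ideal.relNorm_singleton, ← IsFractionRing.finrank_eq (𝓞 L) L (𝓞 F) F] at h1
  exact ⟨_, h1.symm⟩

end ClassGroupBound

/-! ### Classes of units of norm one. -/

section NormOneUnits

open scoped Pointwise

open NumberField IsDedekindDomain

variable {L F : Type*} [Field L] [NumberField L] [Field F] [NumberField F] [Algebra L F]
  [IsGalois L F]

/-- The inclusion of the units of the ring of integers into the field. -/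
def unitsToField (F : Type*) [Field F] : (𝓞 F)ˣ →* Fˣ :=
  Units.map (algebraMap (𝓞 F) F).toMonoidHom

theorem unitsToField_injective (F : Type*) [Field F] : Function.Injective (unitsToField F) :=
  Units.map_injective RingOfIntegers.coe_injective

theorem prod_smul_unitsToField {g : Gal(F/L)} (hg : ∀ x, x ∈ Subgroup.zpowers g) (u : (𝓞 F)ˣ) :
    ((∏ t ∈ Finset.range (orderOf g), (g ^ t) • unitsToField F u : Fˣ) : F) =
      algebraMap L F ((Units.map (RingOfIntegers.norm L) u : (𝓞 L)ˣ) : 𝓞 L) := by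
  classical
  have h1 : (algebraMap L F) ((Units.map (RingOfIntegers.norm L) u : (𝓞 L)ˣ) : 𝓞 L) =
      algebraMap L F (Algebra.norm L ((u : 𝓞 F) : F)) := rfl
  rw [h1, Algebra.norm_eq_prod_automorphisms, Units.coe_prod,
    ← IsCyclic.image_range_orderOf hg, Finset.prod_image]
  · rfl
  · intro a ha b hb h
    exact pow_injOn_Iio_orderOf (by simpa using ha) (by simpa using hb) h

theorem exists_ideal_of_quasiInvariant {N : ℕ} (hN : Module.finrank L F = N) {g : Gal(F/L)}
    (hg : ∀ x, x ∈ Subgroup.zpowers g) (b : Fˣ) (u : (𝓞 F)ˣ)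
    (hu : g • b = unitsToField F u * b) (hb : ramifiedVal L F N b = 1) :
    ∃ (I : Ideal (𝓞 L)) (c : 𝓞 L) (x : 𝓞 F), I ≠ ⊥ ∧ c ≠ 0 ∧
      algebraMap (𝓞 F) F x = algebraMap L F (c : L) * b ∧
      I.map (algebraMap (𝓞 L) (𝓞 F)) = Ideal.span {x} ∧ (I ^ N).IsPrincipal := by
  have hN0 : N ≠ 0 := hN ▸ Module.finrank_pos.ne'
  obtain ⟨d, hd, hint⟩ := ((IsFractionRing.isAlgebraic_iff ℤ ℚ F).2
    (Algebra.IsAlgebraic.isAlgebraic (R := ℚ) (b : F))).exists_integral_multiple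
  rw [zsmul_eq_mul] at hint
  have hdF : (d : F) ≠ 0 := Int.cast_ne_zero.2 hd
  -- The denominator is cleared by an N-th power, so valuations modulo N do not change.
  set c : 𝓞 L := (d : 𝓞 L) ^ N with hc
  set x : 𝓞 F := (d : 𝓞 F) ^ (N - 1) * ⟨_, hint⟩ with hx
  have hcL : algebraMap L F (c : L) = (d : F) ^ N := by
    rw [hc]
    simp
  have hxF : algebraMap (𝓞 F) F x = algebraMap L F (c : L) * b := by
    have h1 : algebraMap (𝓞 F) F x = (d : F) ^ (N - 1) * ((d : F) * b) := by
      refine (map_mul (algebraMap (𝓞 F) F) _ _).trans ?_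
      rw [map_pow, map_intCast]
      rfl
    rw [h1, hcL, ← mul_assoc, ← pow_succ, Nat.sub_add_cancel (Nat.pos_of_ne_zero hN0)]
  have hx0 : x ≠ 0 := by
    intro h
    rw [h, map_zero, hcL, eq_comm, mul_eq_zero] at hxF
    exact hxF.elim (pow_ne_zero N hdF) b.ne_zero
  let a : Fˣ := Units.mk0 (d : F) hdF ^ N * b
  have hxa : (x : F) = a := by
    refine hxF.trans ?_
    rw [hcL]
    rfl
  have ha : ramifiedVal L F N a = 1 := by
    rw [map_mul, hb, mul_one, map_pow]
    funext v
    refine Multiplicative.toAdd.injective ?_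
    change N • Multiplicative.toAdd (ramifiedVal L F N (Units.mk0 (d : F) hdF) v) = 0
    rw [nsmul_eq_mul, ZMod.natCast_self, zero_mul]
  have hgx : g • x = (u : 𝓞 F) * x := by
    apply RingOfIntegers.ext
    have h1 : g (b : F) = ((u : 𝓞 F) : F) * b := congrArg Units.val hu
    change g (algebraMap (𝓞 F) F x) = ((u : 𝓞 F) : F) * algebraMap (𝓞 F) F x
    rw [hxF, map_mul, h1, AlgEquiv.commutes]
    ring
  have hinv : ∀ σ : Gal(F/L), σ • (Ideal.span {x}) = Ideal.span {x} := by
    have h1 : g ∈ MulAction.stabilizer Gal(F/L) (Ideal.span {x}) := by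
      change g • (Ideal.span {x}) = Ideal.span {x}
      rw [Ideal.pointwise_smul_def, Ideal.map_span, Set.image_singleton]
      change Ideal.span {g • x} = _
      rw [hgx, Ideal.span_singleton_mul_left_unit u.isUnit]
    intro σ
    exact (Subgroup.zpowers_le.2 h1) (hg σ)
  obtain ⟨I, hI⟩ := exists_map_eq_span hN hx0 hinv (multiplicity_primeAbove_dvd x a hxa ha)
  refine ⟨I, c, x, ?_, pow_ne_zero N (Int.cast_ne_zero.2 hd), hxF, hI,
    hN ▸ isPrincipal_pow_of_map_eq_span hI⟩
  rintro rfl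
  rw [Ideal.map_bot, eq_comm, Ideal.span_singleton_eq_bot] at hI
  exact hx0 hI

/-- The bound for the classes of units of norm one modulo `g - 1`. -/
theorem relIndex_ker_norm_le (p : ℕ) [hp : Fact p.Prime] {n : ℕ}
    (hn : Module.finrank L F = p ^ n)
    (hμ : NumberField.Units.torsion L ≤
      (NumberField.Units.torsion F).map (Units.map (RingOfIntegers.norm L)))
    {g : Gal(F/L)} (hg : ∀ x, x ∈ Subgroup.zpowers g)
    {R : Type*} [CommRing R] [Module R (Additive (UnitsModTorsion F))] (γ : R)
    (hγ : ∀ x : Additive (UnitsModTorsion F), γ • x = unitsRep L F g x) :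
    ((⊤ : AddSubgroup (Additive (UnitsModTorsion F))).map (sm _ (γ - 1))).relIndex
      (sm (Additive (UnitsModTorsion F)) (gsum γ (p ^ n))).ker ≠ 0 ∧
    ((⊤ : AddSubgroup (Additive (UnitsModTorsion F))).map (sm _ (γ - 1))).relIndex
      (sm (Additive (UnitsModTorsion F)) (gsum γ (p ^ n))).ker ≤
      p ^ (n * (ramifiedPrimes L F).ncard + n * classGroupRank L p) := by
  have hord : orderOf g = p ^ n := by
    rw [orderOf_eq_card_of_forall_mem_zpowers hg, IsGalois.card_aut_eq_finrank, hn]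
  have hpn : NeZero (p ^ n) := ⟨pow_ne_zero _ hp.out.ne_zero⟩
  have hpow : ∀ (t : ℕ) (x : Additive (UnitsModTorsion F)), γ ^ t • x = unitsRep L F (g ^ t) x := by
    intro t
    induction t with
    | zero => simp
    | succ t ih => intro x; rw [pow_succ, pow_succ, mul_smul, ih, hγ, map_mul, Module.End.mul_apply]
  have key : ∀ y : (sm (Additive (UnitsModTorsion F)) (gsum γ (p ^ n))).ker,
      ∃ (u : (𝓞 F)ˣ) (a : Fˣ), unitClass F (Additive.ofMul u) = y.1 ∧
        g • a = unitsToField F u * a := by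
    rintro ⟨y, hy⟩
    obtain ⟨u₀, rfl⟩ := unitClass_surjective F y
    have h1 : unitClass F (Additive.ofMul (∏ t ∈ Finset.range (p ^ n),
        galUnits L F (g ^ t) u₀.toMul)) = 0 := by
      rw [ofMul_prod, map_sum, ← show gsum γ (p ^ n) • unitClass F u₀ = 0 from hy, Finset.sum_smul]
      exact Finset.sum_congr rfl fun t _ => (hpow t (unitClass F u₀)).symm
    rw [unitClass_eq_zero_iff] at h1
    have h2 : ∀ v : (𝓞 F)ˣ, unitsToField F (∏ t ∈ Finset.range (p ^ n), galUnits L F (g ^ t) v) =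
        ∏ t ∈ Finset.range (orderOf g), (g ^ t) • unitsToField F v := fun v => by
      rw [hord, map_prod]
      rfl
    have h3 : Units.map (RingOfIntegers.norm L) u₀.toMul ∈ NumberField.Units.torsion L := by
      obtain ⟨m, hm, hpow1⟩ := isOfFinOrder_iff_pow_eq_one.1 ((CommGroup.mem_torsion _).1 h1)
      refine (CommGroup.mem_torsion _).2 (isOfFinOrder_iff_pow_eq_one.2 ⟨m, hm, ?_⟩)
      have h4 := congrArg (fun z => (unitsToField F z : F)) hpow1
      simp only [map_pow, map_one, h2, Units.val_pow_eq_pow_val, Units.val_one,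
        prod_smul_unitsToField hg] at h4
      rw [← map_pow] at h4
      refine Units.ext (RingOfIntegers.ext ((algebraMap L F).injective ?_))
      refine Eq.trans ?_ (h4.trans (map_one _).symm)
      rw [Units.val_pow_eq_pow_val]
      exact congrArg _ (map_pow (algebraMap (𝓞 L) L) _ m)
    -- Dividing by ζ makes the norm exactly 1 without changing the class modulo torsion.
    obtain ⟨ζ, hζ, hζn⟩ := hμ h3
    have h5 : ∏ t ∈ Finset.range (orderOf g), (g ^ t) • unitsToField F (u₀.toMul * ζ⁻¹) = 1 := by
      apply Units.ext
      rw [prod_smul_unitsToField hg, map_mul, map_inv, hζn, mul_inv_cancel]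
      simp
    obtain ⟨a, ha⟩ := exists_apply_eq_mul_of_prod_eq_one hg _ h5
    refine ⟨u₀.toMul * ζ⁻¹, a, ?_, ha⟩
    rw [ofMul_mul, map_add, (unitClass_eq_zero_iff _).2 (inv_mem hζ), add_zero]
    rfl
  choose u a hua hga using key
  have key2 : ∀ b : Fˣ, ∃ I : (nonZeroDivisors (Ideal (𝓞 L))), ∃ (c : 𝓞 L) (x : 𝓞 F),
      ((∃ w : (𝓞 F)ˣ, g • b = unitsToField F w * b) ∧ ramifiedVal L F (p ^ n) b = 1) →
      c ≠ 0 ∧ algebraMap (𝓞 F) F x = algebraMap L F (c : L) * b ∧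
      I.1.map (algebraMap (𝓞 L) (𝓞 F)) = Ideal.span {x} ∧ (I.1 ^ (p ^ n)).IsPrincipal := by
    intro b
    by_cases h : (∃ w : (𝓞 F)ˣ, g • b = unitsToField F w * b) ∧ ramifiedVal L F (p ^ n) b = 1
    · obtain ⟨⟨w, hw⟩, hb⟩ := h
      obtain ⟨I, c, x, hI, h⟩ := exists_ideal_of_quasiInvariant hn hg b w hw hb
      exact ⟨⟨I, mem_nonZeroDivisors_of_ne_zero hI⟩, c, x, fun _ => h⟩
    -- Irrelevant values, so that the choices are defined on all of Fˣ.
    · exact ⟨1, 1, 1, fun h' => absurd h' h⟩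
  choose I c x hI using key2
  let φ := ramifiedVal L F (p ^ n)
  -- A base point in each nonempty fibre of the valuation map; dividing by it gives `b` with trivial
  -- valuations modulo p^n.
  let base : (ramifiedPrimes L F → Multiplicative (ZMod (p ^ n))) →
      (sm (Additive (UnitsModTorsion F)) (gsum γ (p ^ n))).ker :=
    Function.invFun fun y => φ (a y)
  have hbase : ∀ y, φ (a (base (φ (a y)))) = φ (a y) := fun y =>
    Function.invFun_eq (f := fun y => φ (a y)) ⟨y, rfl⟩
  let b : (sm (Additive (UnitsModTorsion F)) (gsum γ (p ^ n))).ker → Fˣ :=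
    fun y => a y * (a (base (φ (a y))))⁻¹
  have hb := fun y => hI (b y) (by
    refine ⟨⟨u y * (u (base (φ (a y))))⁻¹, ?_⟩, ?_⟩
    · change g • (a y * (a (base (φ (a y))))⁻¹) = _
      rw [smul_mul', smul_inv', hga, hga, map_mul, map_inv, mul_inv]
      exact mul_mul_mul_comm _ _ _ _
    · change φ (a y * (a (base (φ (a y))))⁻¹) = 1
      rw [map_mul, map_inv, hbase, mul_inv_cancel])
  have : Finite (ramifiedPrimes L F) := finite_ramifiedPrimes L F
  let f : (sm (Additive (UnitsModTorsion F)) (gsum γ (p ^ n))).ker →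
      (ramifiedPrimes L F → Multiplicative (ZMod (p ^ n))) ×
        (nsmulAddMonoidHom (α := Additive (ClassGroup (𝓞 L))) (p ^ n)).ker :=
    fun y => (φ (a y), ⟨Additive.ofMul (ClassGroup.mk0 (I (b y))), by
      change ClassGroup.mk0 (I (b y)) ^ (p ^ n) = 1
      rw [← map_pow]
      exact (ClassGroup.mk0_eq_one_iff _).2 (hb y).2.2.2⟩)
  have hfinal := relIndex_le_card (B := (⊤ : AddSubgroup (Additive (UnitsModTorsion F))).map
    (sm _ (γ - 1))) f (by
      intro y y' h
      obtain ⟨h1, h2⟩ := Prod.ext_iff.1 h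
      have h3 : ClassGroup.mk0 (I (b y)) = ClassGroup.mk0 (I (b y')) := congrArg Subtype.val h2
      obtain ⟨r, r', hr, hr', hrr⟩ := ClassGroup.mk0_eq_mk0_iff.1 h3
      obtain ⟨hc, hx, hmap, -⟩ := hb y
      obtain ⟨hc', hx', hmap', -⟩ := hb y'
      have h4 := congrArg (Ideal.map (algebraMap (𝓞 L) (𝓞 F))) hrr
      rw [Ideal.map_mul, Ideal.map_mul, hmap, hmap', Ideal.map_span, Ideal.map_span,
        Set.image_singleton, Set.image_singleton, Ideal.span_singleton_mul_span_singleton,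
        Ideal.span_singleton_mul_span_singleton, Ideal.span_singleton_eq_span_singleton] at h4
      obtain ⟨w, hw⟩ := h4
      obtain ⟨ℓ, hℓ⟩ : ∃ ℓ : L, ℓ = (r : L) * (c (b y) : L) := ⟨_, rfl⟩
      obtain ⟨ℓ', hℓ'⟩ : ∃ ℓ' : L, ℓ' = (r' : L) * (c (b y') : L) := ⟨_, rfl⟩
      have hℓ0 : algebraMap L F ℓ ≠ 0 := by
        rw [Ne, map_eq_zero, hℓ]
        exact mul_ne_zero (RingOfIntegers.coe_ne_zero_iff.2 hr) (RingOfIntegers.coe_ne_zero_iff.2 hc)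
      have h5 : algebraMap L F ℓ * (b y : F) * ((w : 𝓞 F) : F) = algebraMap L F ℓ' * (b y' : F) := by
        have h6 := congrArg (algebraMap (𝓞 F) F) hw
        simp only [map_mul] at h6
        rw [hx, hx'] at h6
        have hr₁ : ∀ s : 𝓞 L, algebraMap (𝓞 F) F (algebraMap (𝓞 L) (𝓞 F) s) =
          algebraMap L F (s : L) := fun _ => rfl
        rw [hr₁, hr₁] at h6
        rw [hℓ, hℓ', map_mul, map_mul]
        linear_combination h6
      have h7 : algebraMap L F ℓ * (a y : F) * ((w : 𝓞 F) : F) = algebraMap L F ℓ' * (a y' : F) := by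
        have h8 : φ (a y) = φ (a y') := h1
        simp only [b, h8, Units.val_mul] at h5
        have h9 := ((a (base (φ (a y'))))⁻¹ : Fˣ).ne_zero
        refine mul_right_cancel₀ h9 ?_
        linear_combination h5
      have hgy : g (a y : F) = ((u y : 𝓞 F) : F) * a y := congrArg Units.val (hga y)
      have hgy' : g (a y' : F) = ((u y' : 𝓞 F) : F) * a y' := congrArg Units.val (hga y')
      have h10 := congrArg g h7
      rw [map_mul, map_mul, map_mul, AlgEquiv.commutes, AlgEquiv.commutes, hgy, hgy'] at h10
      -- Equal valuations and equal ideal classes give a y · w = a y' up to a factor from L, which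
      -- `g` fixes; comparing with the image under `g` yields this relation.
      have h11 : u y * galUnits L F g w = u y' * w := by
        apply unitsToField_injective F
        apply Units.ext
        rw [map_mul, map_mul, Units.val_mul, Units.val_mul]
        change ((u y : 𝓞 F) : F) * g ((w : 𝓞 F) : F) = ((u y' : 𝓞 F) : F) * ((w : 𝓞 F) : F)
        refine mul_left_cancel₀ (mul_ne_zero hℓ0 (a y).ne_zero) ?_
        linear_combination h10 - ((u y' : 𝓞 F) : F) * h7
      refine ⟨-unitClass F (Additive.ofMul w), trivial, ?_⟩
      change (γ - 1) • -unitClass F (Additive.ofMul w) = (y.1 - y'.1 : Additive (UnitsModTorsion F))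
      have h12 := congrArg (fun z => unitClass F (Additive.ofMul z)) h11
      simp only [ofMul_mul, map_add] at h12
      rw [hua, hua, ← unitsRep_unitClass, ← hγ] at h12
      rw [smul_neg, sub_smul, one_smul, neg_sub, eq_comm, sub_eq_sub_iff_add_eq_add, h12, add_comm])
  refine ⟨hfinal.1, hfinal.2.trans ?_⟩
  rw [Nat.card_prod, Nat.card_fun, pow_add]
  refine Nat.mul_le_mul (le_of_eq ?_) (card_ker_nsmul_pow_le p _ n)
  rw [pow_mul, Nat.card_coe_set_eq]
  congr 1
  exact Nat.card_zmod _

end NormOneUnits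

/-! ### Assembling the bound. -/

section Main

open NumberField Polynomial

theorem card_invariants_padicUnitsRep_mul_le (p : ℕ) [hp : Fact p.Prime] (hp2 : p ≠ 2)
    (L F : Type*) [Field L] [NumberField L] [Field F] [NumberField F] [Algebra L F]
    [IsGalois L F] [IsCyclic Gal(F/L)] (m i : ℕ) (hn : Module.finrank L F = p ^ (m + i))
    (hμ : NumberField.Units.torsion L ≤
      (NumberField.Units.torsion F).map (Units.map (RingOfIntegers.norm L)))
    (N : Subgroup Gal(F/L)) (hN : Nat.card N = p ^ i) :
    Finite (conjRep (padicUnitsRep L F p) N).invariants ∧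
      Nat.card (conjRep (padicUnitsRep L F p) N).invariants * p ^ m ≤
        p ^ ((m + i) * (ramifiedPrimes L F).ncard + (m + i) * classGroupRank L p) := by
  obtain ⟨g, hg⟩ := IsCyclic.exists_generator (α := Gal(F/L))
  have hord : orderOf g = p ^ (m + i) := by
    rw [orderOf_eq_card_of_forall_mem_zpowers hg, IsGalois.card_aut_eq_finrank, hn]
  let E := Additive (UnitsModTorsion F)
  let M := ℤ_[p] ⊗[ℤ] E
  let φ : Module.End ℤ E := unitsRep L F g
  let ψ : Module.End ℤ M := (padicUnitsRep L F p g).restrictScalars ℤ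
  -- Letting X act as `g` on both modules supplies the common commutative ring of operators.
  let _ : Module ℤ[X] E := Module.compHom E (aeval φ : ℤ[X] →ₐ[ℤ] Module.End ℤ E).toRingHom
  let _ : Module ℤ[X] M := Module.compHom M (aeval ψ : ℤ[X] →ₐ[ℤ] Module.End ℤ M).toRingHom
  have hγE : ∀ x : E, (X : ℤ[X]) • x = unitsRep L F g x := fun x =>
    congrArg (fun f : Module.End ℤ E => f x) (aeval_X φ)
  have hγM : ∀ x : M, (X : ℤ[X]) • x = padicUnitsRep L F p g x := fun x =>
    congrArg (fun f : Module.End ℤ M => f x) (aeval_X ψ)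
  let ι : E →ₗ[ℤ[X]] M :=
    { toFun := fun e => (1 : ℤ_[p]) ⊗ₜ e
      map_add' := fun e e' => TensorProduct.tmul_add _ _ _
      map_smul' := fun f e => by
        change (1 : ℤ_[p]) ⊗ₜ[ℤ] (f • e) = f • ((1 : ℤ_[p]) ⊗ₜ[ℤ] e : M)
        induction f using Polynomial.induction_on' generalizing e with
        | add f f' h h' => rw [add_smul, add_smul, TensorProduct.tmul_add, h, h']
        | monomial k c =>
          rw [← C_mul_X_pow_eq_monomial, mul_smul, mul_smul]
          have hC : ∀ x : E, (C c : ℤ[X]) • x = c • x := fun x =>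
            congrArg (fun f : Module.End ℤ E => f x) (aeval_C φ c)
          have hC' : ∀ x : M, (C c : ℤ[X]) • x = c • x := fun x =>
            congrArg (fun f : Module.End ℤ M => f x) (aeval_C ψ c)
          rw [hC, hC', TensorProduct.tmul_smul]
          congr 1
          induction k generalizing e with
          | zero => rw [pow_zero, one_smul, one_smul]
          | succ k ih =>
            rw [pow_succ, mul_smul, mul_smul, ih, hγE, hγM]
            rfl }
  have hpow : ∀ (t : ℕ) (x : E), (X : ℤ[X]) ^ t • x = unitsRep L F (g ^ t) x := by
    intro t
    induction t with
    | zero => simp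
    | succ t ih =>
      intro x
      rw [pow_succ, pow_succ, mul_smul, ih, hγE, map_mul, Module.End.mul_apply]
  have hone : ∀ x : E, (X : ℤ[X]) ^ p ^ (m + i) • x = x := fun x => by
    rw [hpow, ← hord, pow_orderOf_eq_one, map_one, Module.End.one_apply]
  have hrank : ∀ j ≤ m, Module.finrank ℤ (sm E ((X : ℤ[X]) ^ p ^ j - 1)).ker + 1 =
      p ^ j * Fintype.card (InfinitePlace L) := by
    intro j hj
    rw [← rank_fixedField_add_one L F p hp2 hn g hg (hj.trans (Nat.le_add_right m i)),
      ← finrank_fixed_units]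
    have h1 : sm E ((X : ℤ[X]) ^ p ^ j - 1) =
        (unitsRep L F (g ^ p ^ j)).toAddMonoidHom - AddMonoidHom.id E := by
      refine AddMonoidHom.ext fun x => ?_
      change ((X : ℤ[X]) ^ p ^ j - 1) • (x : E) = (unitsRep L F (g ^ p ^ j) x - x : E)
      rw [sub_smul, one_smul, hpow]
    rw [h1]
  have hnorm := relIndex_ker_norm_le (L := L) (F := F) p hn hμ hg (X : ℤ[X]) hγE
  have hclasses := relIndex_fixedClasses_mul_le (E := E) p (X : ℤ[X]) _ m i hone hrank hnorm.1
  have hNg : N = Subgroup.zpowers (g ^ p ^ m) := by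
    refine Subgroup.eq_of_le_of_card_ge ?_ (le_of_eq ?_)
    · intro h hh
      obtain ⟨t, rfl⟩ := mem_powers_iff_mem_zpowers.2 (hg h)
      have h1 : (g ^ t) ^ p ^ i = 1 := by
        rw [← hN]
        exact congrArg Subtype.val (pow_card_eq_one' (x := (⟨_, hh⟩ : N)))
      have h2 := orderOf_dvd_of_pow_eq_one ((pow_mul g t (p ^ i)).trans h1)
      rw [hord, pow_add] at h2
      obtain ⟨c, rfl⟩ := Nat.dvd_of_mul_dvd_mul_right (pow_pos hp.out.pos i) h2
      exact ⟨c, by simp [pow_mul]⟩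
    rw [hN, Nat.card_zpowers, orderOf_pow_of_dvd (pow_ne_zero _ hp.out.ne_zero)
      (hord ▸ pow_dvd_pow p (Nat.le_add_right m i)), hord, pow_add,
      Nat.mul_div_cancel_left _ (pow_pos hp.out.pos m)]
  have hinv := card_invariants_le (padicUnitsRep L F p) N ι X g hγM (p ^ m) (p ^ i) hNg
    (by rw [← pow_add, ← hord, pow_orderOf_eq_one]) (fun x => by rw [← pow_add, hone])
    (fun x hx => eq_zero_of_nsmul_eq_zero (pow_ne_zero _ hp.out.ne_zero) hx)
    (fun x hx => eq_zero_of_nsmul_tensor p i x hx)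
    (fun x => by rw [← pow_add]; exact exists_tensor_approx p (i + i) x)
    (fun e y h => by rw [← pow_add] at h ⊢; exact exists_eq_pow_smul_of_tensor p (i + i) e y h)
    hclasses.1
  exact ⟨hinv.1, (Nat.mul_le_mul_right _ hinv.2).trans (hclasses.2.trans hnorm.2)⟩

end Main

end UnitCohomology

theorem mainTheorem5 (p : ℕ) [Fact p.Prime] (hp : p ≠ 2)
    (L F : Type*) [Field L] [NumberField L] [Field F] [NumberField F] [Algebra L F]
    [IsGalois L F] [IsCyclic Gal(F/L)]
    (n : ℕ) (hn : Module.finrank L F = p ^ n)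
    (hμ : (NumberField.Units.torsion F).map (Units.map (RingOfIntegers.norm L)) =
      NumberField.Units.torsion L)
    (i : ℕ) (hi : 1 ≤ i) (hin : i < n)
    (Γi : Subgroup Gal(F/L)) (hΓi : Nat.card Γi = p ^ i) :
    Finite (UnitCohomology.conjRep (UnitCohomology.padicUnitsRep L F p) Γi).invariants ∧
    (padicValNat p
        (Nat.card (UnitCohomology.conjRep (UnitCohomology.padicUnitsRep L F p) Γi).invariants) : ℤ)
      ≤ ((UnitCohomology.ramifiedPrimes L F).ncard : ℤ) * i * (2 + n - i)
        + (UnitCohomology.classGroupRank L p : ℤ) * i * (n - i + 1) - i * n + i ^ 2 := by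
  obtain ⟨m, rfl⟩ := Nat.exists_eq_add_of_le' hin.le
  obtain ⟨hfin, hle⟩ := UnitCohomology.card_invariants_padicUnitsRep_mul_le p hp L F m i hn hμ.ge
    Γi hΓi
  refine ⟨hfin, ?_⟩
  have hp1 : 1 < p := (Fact.out : p.Prime).one_lt
  generalize (UnitCohomology.ramifiedPrimes L F).ncard = r at *
  generalize UnitCohomology.classGroupRank L p = δ at *
  have h1 := Nat.le_of_dvd Nat.card_pos (pow_padicValNat_dvd (p := p)
    (n := Nat.card (UnitCohomology.conjRep (UnitCohomology.padicUnitsRep L F p) Γi).invariants))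
  generalize padicValNat p _ = v at *
  have h2 : v + m ≤ (m + i) * r + (m + i) * δ := by
    rw [← Nat.pow_le_pow_iff_right hp1, pow_add]
    exact (Nat.mul_le_mul_right _ h1).trans hle
  have hm : 1 ≤ m := by omega
  -- If r = δ = 0, the bound would read v + m ≤ 0, contradicting i < n.
  have hd : 1 ≤ r + δ := by
    by_contra h
    obtain ⟨rfl, rfl⟩ : r = 0 ∧ δ = 0 := by omega
    simp at h2
    omega
  zify at h2 hi hm hd
  push_cast
  -- The target exceeds n(r + δ) - m by exactly (i - 1) m (r + δ - 1) + r i.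
  have h3 : (m : ℤ) * (r + δ - 1) ≤ i * (m * (r + δ - 1)) :=
    le_mul_of_one_le_left (mul_nonneg (by positivity) (by linarith)) hi
  have h4 : (0 : ℤ) ≤ r * i := by positivity
  linarith
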